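/- Let $x,y$ be variables over $\mathbf C$, and let $\mathcal G=\langle T,D\rangle\subset GL_2(\mathbf C)$ be the group generated by \[ T=\frac{1+i}{2}\begin{pmatrix}1&1\\1&-1\end{pmatrix},\qquad D=\begin{pmatrix}1&0\\0&i\end{pmatrix}. \] It acts on $\mathbf C[x,y]$ by $(g.f)\binom xy=f\!\left(g\binom xy\right)$. For a representation $\rho:\mathcal G\to GL_m(\mathbf C)$ let \[ M(\rho)=\{F\in\mathbf C[x,y]^m : F(g\tbinom xy)=\rho(g)F(\tbinom xy)\ \text{for all } g\in\mathcal G\}, \] a module over the invariant ring $\mathbf C[x,y]^{\mathcal G}$. Let $M(\rho)_k$ be the finite-dimensional space of those $F\in M(\rho)$ whose entries are homogeneous of degree $k$ (or zero), and let $H_{M(\rho)}(t)=\sum_{k\ge0}\dim_{\mathbf C}M(\rho)_k\,t^k$. Theorem. The group $\mathcal G$ has order $96$, and $\mathbf C[x,y]^{\mathcal G}=\mathbf C[\theta,\varphi]$, where $\theta=x^8+14x^4y^4+y^8$ and $\varphi=x^{12}-33x^8y^4-33x^4y^8+y^{12}$ are algebraically independent. For each of the following five pairs of values on the generators $T$ and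 $D$ there is an irreducible representation of $\mathcal G$ with these values (necessarily unique), and the following hold; "free on" means that the listed elements form a basis over $\mathbf C[x,y]^{\mathcal G}$. 1. $\rho_3(T)=-i$, $\rho_3(D)=i$: $M(\rho_3)$ is free on $-x^5y+xy^5$, of degree $6$, and \[H_{M(\rho_3)}(t)=\frac{t^6}{(1-t^8)(1-t^{12})}=t^6+t^{14}+t^{18}+t^{22}+t^{26}+\cdots.\] 2. $\rho_5(T)=-\frac12\begin{pmatrix}1&1\\3&-1\end{pmatrix}$, $\rho_5(D)=\mathrm{diag}(1,-1)$: $M(\rho_5)$ is free on \[\begin{pmatrix}x^4+y^4\\6x^2y^2\end{pmatrix},\ \begin{pmatrix}-x^8+10x^4y^4-y^8\\12x^6y^2+12x^2y^6\end{pmatrix},\] of degrees $4,8$, and \[H_{M(\rho_5)}(t)=\frac{t^4+t^8}{(1-t^8)(1-t^{12})}=t^4+t^8+t^{12}+2t^{16}+2t^{20}+\cdots.\] 3. $\rho_{10}(T)=T$, $\rho_{10}(D)=D$: $M(\rho_{10})$ is free on \[\begin{pmatrix}x\\y\end{pmatrix},\ \begin{pmatrix}-x^5+5xy^4\\5x^4y-y^5\end{pmatrix},\]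 of degrees $1,5$, and \[H_{M(\rho_{10})}(t)=\frac{t+t^5}{(1-t^8)(1-t^{12})}=t+t^5+t^9+2t^{13}+2t^{17}+2t^{21}+\cdots.\] 4. $\rho_{13}(T)=\frac i2\begin{pmatrix}1&2&1\\1&0&-1\\1&-2&1\end{pmatrix}$, $\rho_{13}(D)=\mathrm{diag}(1,i,-1)$: $M(\rho_{13})$ is free on \[\begin{pmatrix}x^2\\xy\\y^2\end{pmatrix},\ \begin{pmatrix}-x^6+5x^2y^4\\2x^5y+2xy^5\\5x^4y^2-y^6\end{pmatrix},\ \begin{pmatrix}-x^2(x^4-5y^4)^2\\xy(5x^4-y^4)(x^4-5y^4)\\-y^2(5x^4-y^4)^2\end{pmatrix},\] of degrees $2,6,10$, and \[H_{M(\rho_{13})}(t)=\frac{t^2+t^6+t^{10}}{(1-t^8)(1-t^{12})}=t^2+t^6+2t^{10}+2t^{14}+3t^{18}+3t^{22}+\cdots.\] 5. $\rho_{15}(T)=\frac{-1+i}4\begin{pmatrix}1&3&3&1\\1&1&-1&-1\\1&-1&-1&1\\1&-3&3&-1\end{pmatrix}$, $\rho_{15}(D)=\mathrm{diag}(1,i,-1,-i)$: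 $M(\rho_{15})$ is free on \[ \begin{pmatrix}x^3\\x^2y\\xy^2\\y^3\end{pmatrix},\ \begin{pmatrix}-x^7+5x^3y^4\\x^6y+3x^2y^5\\3x^5y^2+xy^6\\5x^4y^3-y^7\end{pmatrix},\ \begin{pmatrix}-6x^7y^4+6x^3y^8\\-x^{10}y+x^2y^9\\x^9y^2-xy^{10}\\6x^8y^3-6x^4y^7\end{pmatrix},\ \begin{pmatrix}-24x^{11}y^4+24x^7y^8\\x^{14}y-7x^{10}y^5+3x^6y^9+3x^2y^{13}\\3x^{13}y^2+3x^9y^6-7x^5y^{10}+xy^{14}\\24x^8y^7-24x^4y^{11}\end{pmatrix}, \] of degrees $3,7,11,15$, and \[H_{M(\rho_{15})}(t)=\frac{t^3+t^7+t^{11}+t^{15}}{(1-t^8)(1-t^{12})}=t^3+t^7+2t^{11}+3t^{15}+3t^{19}+4t^{23}+\cdots.\] -/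

import Mathlib

open scoped MatrixGroups

noncomputable section

namespace VectorInvariants

/-- The substitution `f(x) ↦ f(g x)`, where `x` is the column vector of the variables. -/
def subst {n : ℕ} (g : GL (Fin n) ℂ) :
    MvPolynomial (Fin n) ℂ →ₐ[ℂ] MvPolynomial (Fin n) ℂ :=
  MvPolynomial.aeval fun i => ∑ j, MvPolynomial.C (g.val i j) * MvPolynomial.X j

/-- The invariant ring `ℂ[x]^G`. -/
def invariantRing {n : ℕ} (G : Subgroup (GL (Fin n) ℂ)) :
    Subalgebra ℂ (MvPolynomial (Fin n) ℂ) where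
  carrier := {f | ∀ g ∈ G, subst g f = f}
  mul_mem' := fun ha hb g hg => by rw [map_mul, ha g hg, hb g hg]
  add_mem' := fun ha hb g hg => by rw [map_add, ha g hg, hb g hg]
  algebraMap_mem' := fun r g _ => (subst g).commutes r

/-- The product `A F` of a complex matrix with a column vector of polynomials. -/
def matMulVec {n m : ℕ} (A : Matrix (Fin m) (Fin m) ℂ)
    (F : Fin m → MvPolynomial (Fin n) ℂ) : Fin m → MvPolynomial (Fin n) ℂ :=
  (A.map MvPolynomial.C).mulVec F

/-- The `ℂ[x]^G`-module `M(ρ)` of vector-valued invariants: all `F` with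
`F(g x) = ρ(g) F(x)` for every `g ∈ G`. -/
def vectorInvariants {n m : ℕ} {G : Subgroup (GL (Fin n) ℂ)} (ρ : G →* GL (Fin m) ℂ) :
    Submodule (invariantRing G) (Fin m → MvPolynomial (Fin n) ℂ) where
  carrier := {F | ∀ g : G, (fun i => subst g.val (F i)) = matMulVec (ρ g).val F}
  add_mem' := by
    intro F F' hF hF' g
    have h1 := hF g
    have h2 := hF' g
    funext i
    simpa [matMulVec, Matrix.mulVec_add] using congrArg₂ (· + ·) (congrFun h1 i) (congrFun h2 i)
  zero_mem' := by
    intro g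
    funext i
    simp [matMulVec]
  smul_mem' := by
    intro c F hF g
    have h1 := hF g
    have hc : subst g.val c.val = c.val := c.property g.val g.property
    funext i
    have h2 := congrFun h1 i
    simp only [Pi.smul_apply, Algebra.smul_def, map_mul] at h2 ⊢
    change subst g.val c.val * subst g.val (F i) = _
    rw [hc, h2]
    simp only [matMulVec, Matrix.mulVec, dotProduct, Finset.mul_sum]
    refine Finset.sum_congr rfl fun j _ => ?_
    change _ = _ * (c.val * F j)
    ring

instance {n m : ℕ} {G : Subgroup (GL (Fin n) ℂ)} (ρ : G →* GL (Fin m) ℂ) :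
    Module (invariantRing G) (vectorInvariants ρ) :=
  (vectorInvariants ρ).module

/-- The column vectors of polynomials all of whose entries are homogeneous of degree `k`
(or zero). -/
def homogeneousVectors (n m k : ℕ) : Submodule ℂ (Fin m → MvPolynomial (Fin n) ℂ) :=
  Submodule.pi Set.univ fun _ => MvPolynomial.homogeneousSubmodule (Fin n) ℂ k

/-- The complex vector space of elements of degree `k` in `M(ρ)`. -/
def degreePart {n m : ℕ} {G : Subgroup (GL (Fin n) ℂ)} (ρ : G →* GL (Fin m) ℂ) (k : ℕ) :
    Submodule ℂ (Fin m → MvPolynomial (Fin n) ℂ) :=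
  (vectorInvariants ρ).restrictScalars ℂ ⊓ homogeneousVectors n m k

/-- The degree parts are finite-dimensional, so that `Module.finrank` is their dimension. -/
theorem degreePart_finiteDimensional {n m : ℕ} {G : Subgroup (GL (Fin n) ℂ)}
    (ρ : G →* GL (Fin m) ℂ) (k : ℕ) : FiniteDimensional ℂ (degreePart ρ k) := by
  have h : (homogeneousVectors n m k).FG :=
    Submodule.fg_pi fun _ => MvPolynomial.homogeneousSubmodule_fg (Fin n) ℂ k
  have : FiniteDimensional ℂ (homogeneousVectors n m k) := Module.Finite.iff_fg.mpr h
  exact Submodule.finiteDimensional_of_le (inf_le_right : degreePart ρ k ≤ _)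

/-- The dimension formula (Hilbert series) `∑ₖ dim M(ρ)ₖ tᵏ`. -/
def hilbertSeries {n m : ℕ} {G : Subgroup (GL (Fin n) ℂ)} (ρ : G →* GL (Fin m) ℂ) :
    PowerSeries ℚ :=
  PowerSeries.mk fun k => (Module.finrank ℂ (degreePart ρ k) : ℚ)

/-- The list `F` is a basis of `M(ρ)` over `ℂ[x]^G`, i.e. `M(ρ)` is a free
`ℂ[x]^G`-module on the generators `F 0, …, F (r - 1)`. -/
def IsFreeOn {n m r : ℕ} {G : Subgroup (GL (Fin n) ℂ)} (ρ : G →* GL (Fin m) ℂ)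
    (F : Fin r → Fin m → MvPolynomial (Fin n) ℂ) : Prop :=
  ∃ b : Module.Basis (Fin r) (invariantRing G) (vectorInvariants ρ),
    ∀ j, (b j : Fin m → MvPolynomial (Fin n) ℂ) = F j

/-- The linear representation on column vectors given by the matrices `ρ(g)`. -/
def linearRep {n m : ℕ} {G : Subgroup (GL (Fin n) ℂ)} (ρ : G →* GL (Fin m) ℂ) :
    Representation ℂ G (Fin m → ℂ) where
  toFun g := (ρ g).val.mulVecLin
  map_one' := by simp [Module.End.one_eq_id]
  map_mul' g h := by simp [Matrix.mulVecLin_mul, Module.End.mul_eq_comp]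

/-- The matrix `T = (1 + i)/2 · (1 1; 1 -1)`. -/
def T : GL (Fin 2) ℂ :=
  Matrix.GeneralLinearGroup.mkOfDetNeZero (((1 + Complex.I) / 2) • !![1, 1; 1, -1]) (by
    have h : (1 + Complex.I) ≠ 0 := fun h => by simpa using congrArg Complex.re h
    rw [Matrix.det_smul, Matrix.det_fin_two_of]
    refine mul_ne_zero (pow_ne_zero _ (div_ne_zero h two_ne_zero)) ?_
    norm_num)

/-- The matrix `D = diag(1, i)`. -/
def D : GL (Fin 2) ℂ :=
  Matrix.GeneralLinearGroup.mkOfDetNeZero !![1, 0; 0, Complex.I] (by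
    simp [Matrix.det_fin_two_of])

/-- The group `𝒢 = ⟨T, D⟩`. -/
def 𝒢 : Subgroup (GL (Fin 2) ℂ) := Subgroup.closure {T, D}

/-- `T` as an element of `𝒢`. -/
def T' : 𝒢 := ⟨T, Subgroup.subset_closure (by simp)⟩

/-- `D` as an element of `𝒢`. -/
def D' : 𝒢 := ⟨D, Subgroup.subset_closure (by simp)⟩

/-- The representation `ρ` of `𝒢` sends `T` to `A` and `D` to `B`. -/
def HasValues {m : ℕ} (ρ : 𝒢 →* GL (Fin m) ℂ) (A B : Matrix (Fin m) (Fin m) ℂ) : Prop :=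
  (ρ T').val = A ∧ (ρ D').val = B

/-- The variable `x`. -/
def x : MvPolynomial (Fin 2) ℂ := MvPolynomial.X 0

/-- The variable `y`. -/
def y : MvPolynomial (Fin 2) ℂ := MvPolynomial.X 1

/-- The invariant `θ` of degree 8. -/
def θ : MvPolynomial (Fin 2) ℂ := x ^ 8 + 14 * x ^ 4 * y ^ 4 + y ^ 8

/-- The invariant `φ` of degree 12. -/
def φ : MvPolynomial (Fin 2) ℂ := x ^ 12 - 33 * x ^ 8 * y ^ 4 - 33 * x ^ 4 * y ^ 8 + y ^ 12

/-- The generator of `M(ρ₃)`. -/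
def gen₃ : Fin 1 → Fin 1 → MvPolynomial (Fin 2) ℂ :=
  ![![-x ^ 5 * y + x * y ^ 5]]

/-- The generators of `M(ρ₅)`. -/
def gen₅ : Fin 2 → Fin 2 → MvPolynomial (Fin 2) ℂ :=
  ![![x ^ 4 + y ^ 4, 6 * x ^ 2 * y ^ 2],
    ![-x ^ 8 + 10 * x ^ 4 * y ^ 4 - y ^ 8, 12 * x ^ 6 * y ^ 2 + 12 * x ^ 2 * y ^ 6]]

/-- The generators of `M(ρ₁₀)`. -/
def gen₁₀ : Fin 2 → Fin 2 → MvPolynomial (Fin 2) ℂ :=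
  ![![x, y],
    ![-x ^ 5 + 5 * x * y ^ 4, 5 * x ^ 4 * y - y ^ 5]]

/-- The generators of `M(ρ₁₃)`. -/
def gen₁₃ : Fin 3 → Fin 3 → MvPolynomial (Fin 2) ℂ :=
  ![![x ^ 2, x * y, y ^ 2],
    ![-x ^ 6 + 5 * x ^ 2 * y ^ 4, 2 * x ^ 5 * y + 2 * x * y ^ 5, 5 * x ^ 4 * y ^ 2 - y ^ 6],
    ![-x ^ 2 * (x ^ 4 - 5 * y ^ 4) ^ 2,
      x * y * (5 * x ^ 4 - y ^ 4) * (x ^ 4 - 5 * y ^ 4),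
      -y ^ 2 * (5 * x ^ 4 - y ^ 4) ^ 2]]

/-- The generators of `M(ρ₁₅)`. -/
def gen₁₅ : Fin 4 → Fin 4 → MvPolynomial (Fin 2) ℂ :=
  ![![x ^ 3, x ^ 2 * y, x * y ^ 2, y ^ 3],
    ![-x ^ 7 + 5 * x ^ 3 * y ^ 4,
      x ^ 6 * y + 3 * x ^ 2 * y ^ 5,
      3 * x ^ 5 * y ^ 2 + x * y ^ 6,
      5 * x ^ 4 * y ^ 3 - y ^ 7],
    ![-6 * x ^ 7 * y ^ 4 + 6 * x ^ 3 * y ^ 8,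
      -x ^ 10 * y + x ^ 2 * y ^ 9,
      x ^ 9 * y ^ 2 - x * y ^ 10,
      6 * x ^ 8 * y ^ 3 - 6 * x ^ 4 * y ^ 7],
    ![-24 * x ^ 11 * y ^ 4 + 24 * x ^ 7 * y ^ 8,
      x ^ 14 * y - 7 * x ^ 10 * y ^ 5 + 3 * x ^ 6 * y ^ 9 + 3 * x ^ 2 * y ^ 13,
      3 * x ^ 13 * y ^ 2 + 3 * x ^ 9 * y ^ 6 - 7 * x ^ 5 * y ^ 10 + x * y ^ 14,
      24 * x ^ 8 * y ^ 7 - 24 * x ^ 4 * y ^ 11]]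

/-- Every entry of `F j` is homogeneous of degree `d j` (or zero). -/
def HasDegrees {r m : ℕ} (F : Fin r → Fin m → MvPolynomial (Fin 2) ℂ) (d : Fin r → ℕ) : Prop :=
  ∀ j i, (F j i).IsHomogeneous (d j)

/-- The rational function `(t^{d₀} + ⋯ + t^{d_{r-1}}) / ((1 - t⁸)(1 - t¹²))` as a power series. -/
def rationalSeries {r : ℕ} (d : Fin r → ℕ) : PowerSeries ℚ :=
  (∑ j, PowerSeries.X ^ d j) *
    ((1 - PowerSeries.X ^ 8) * (1 - PowerSeries.X ^ 12) : PowerSeries ℚ)⁻¹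

end VectorInvariants

end

/-!
The group `𝒢` is a reflection group. Its mirrors are the six zero lines of
`f = -x⁵y + xy⁵` (`mirrorProduct`); they form one orbit, and `D` is a reflection of order four
in the mirror `y = 0`. Everything rests on one divisibility principle, `mirrorProduct_pow_dvd`: a
relative invariant of `𝒢` divisible by `yᵏ` is divisible by `fᵏ`.

* Order. Every element of `𝒢` is, up to a power of the scalar `i = T²`, of the form `Dᵇ`, `Dᵇ W`
  or `Dᶜ T Dᵇ`, where `W = T D² T` is antidiagonal (`exists_normalForm`). These are
  `16 + 16 + 64` distinct matrices.

* Invariants. An invariant form vanishing on `y = 0` is divisible by `y⁴`, hence by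
  `f⁴ = (θ³ - φ²) / 108`. Every value of an invariant form on the line `y = 0` is taken by a
  polynomial in `θ` and `φ` of the same degree: the degree is a multiple of four since `i ∈ 𝒢`, and
  degree four does not occur (`exists_mem_adjoin_eval_eq`). So an induction on the degree shows that
  `θ` and `φ` generate. They are algebraically independent because `(θ, φ)` maps `ℂ²` onto `ℂ²`.

* Existence of the representations. In each case the entries of the first generator are linearly
  independent and span a `𝒢`-stable space, which defines `ρ` (`exists_representation`). It is
  irreducible since `D` has distinct eigenvalues and `T` connects the eigenvectors.

* Freeness. If `ρ(D)` is diagonal with entries `i ^ (e k)`, `0 ≤ e k < 4`, then every determinant of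
  elements of `M(ρ)` is divisible by `f ^ ∑ e k`. The determinant of the given generators is a
  nonzero constant times this power, so Cramer's rule gives polynomial, and then invariant,
  coordinates (`isFreeOn_of_det`).

* Hilbert series. The vectors `θᵃ φᵇ Fⱼ` form a basis of `M(ρ)` over `ℂ`, so the dimension in
  degree `k` is the number of triples with `d j + 8a + 12b = k` (`finrank_degreePart`).
-/

noncomputable section

namespace VectorInvariants

open MvPolynomial

/-! ### Substitutions -/

section Substitution

variable {n : ℕ}

theorem subst_X (g : GL (Fin n) ℂ) (i : Fin n) :
    subst g (X i) = ∑ j, C (g.val i j) * X j := by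
  simp [subst]

theorem subst_C (g : GL (Fin n) ℂ) (c : ℂ) : subst g (C c) = C c :=
  (subst g).commutes c

theorem subst_one (f : MvPolynomial (Fin n) ℂ) : subst 1 f = f := by
  have h : subst (1 : GL (Fin n) ℂ) = AlgHom.id ℂ _ := by
    ext1 i
    simp [subst_X, Matrix.one_apply]
  rw [h, AlgHom.id_apply]

/-- Substitution is a right action, so the order of the factors is reversed. -/
theorem subst_subst (g h : GL (Fin n) ℂ) (f : MvPolynomial (Fin n) ℂ) :
    subst g (subst h f) = subst (h * g) f := by
  have : (subst g).comp (subst h) = subst (h * g) := by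
    ext1 i
    simp only [AlgHom.comp_apply, subst_X, map_sum, map_mul, subst_C, Units.val_mul,
      Matrix.mul_apply, Finset.mul_sum, Finset.sum_mul]
    rw [Finset.sum_comm]
    simp only [mul_assoc]
  rw [← this, AlgHom.comp_apply]

theorem subst_inv_subst (g : GL (Fin n) ℂ) (f : MvPolynomial (Fin n) ℂ) :
    subst g⁻¹ (subst g f) = f := by
  rw [subst_subst, mul_inv_cancel, subst_one]

theorem subst_injective (g : GL (Fin n) ℂ) : Function.Injective (subst g) :=
  Function.LeftInverse.injective (subst_inv_subst g)

/-- Substitution by `g` as an algebra automorphism. -/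
def substEquiv (g : GL (Fin n) ℂ) : MvPolynomial (Fin n) ℂ ≃ₐ[ℂ] MvPolynomial (Fin n) ℂ :=
  AlgEquiv.ofAlgHom (subst g) (subst g⁻¹)
    (AlgHom.ext fun f => by simp [subst_subst, subst_one])
    (AlgHom.ext fun f => by simp [subst_subst, subst_one])

theorem prime_subst_X (g : GL (Fin n) ℂ) (i : Fin n) : Prime (subst g (X i)) :=
  (MulEquiv.prime_iff (substEquiv g)).2 (X_prime)

theorem eval_subst (g : GL (Fin n) ℂ) (p : Fin n → ℂ) (f : MvPolynomial (Fin n) ℂ) :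
    eval p (subst g f) = eval (g.val.mulVec p) f := by
  have : (aeval p).comp (subst g) = aeval (R := ℂ) (g.val.mulVec p) := by
    ext1 i
    simp [subst_X, Matrix.mulVec, dotProduct]
  simpa [aeval_eq_eval] using DFunLike.congr_fun this f

theorem isHomogeneous_subst (g : GL (Fin n) ℂ) {f : MvPolynomial (Fin n) ℂ} {k : ℕ}
    (hf : f.IsHomogeneous k) : (subst g f).IsHomogeneous k := by
  have := hf.aeval (S := ℂ) (n := 1) (fun i => ∑ j, C (g.val i j) * X j)
    fun i => IsHomogeneous.sum _ _ _ fun j _ => isHomogeneous_C_mul_X _ _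
  simpa [subst] using this

theorem subst_homogeneousComponent (g : GL (Fin n) ℂ) (k : ℕ) (f : MvPolynomial (Fin n) ℂ) :
    subst g (homogeneousComponent k f) = homogeneousComponent k (subst g f) := by
  conv_rhs => rw [← sum_homogeneousComponent f, map_sum, map_sum]
  have h : ∀ i, homogeneousComponent k (subst g (homogeneousComponent i f)) =
      if i = k then subst g (homogeneousComponent i f) else 0 := fun i =>
    homogeneousComponent_of_mem (isHomogeneous_subst g (homogeneousComponent_isHomogeneous i f))
      |>.trans (by simp only [eq_comm])
  simp only [h, Finset.sum_ite_eq', Finset.mem_range]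
  split_ifs with hk
  · rfl
  · rw [homogeneousComponent_eq_zero _ _ (by omega), map_zero]

end Substitution

/-! ### The generators of the group and the product of the mirrors -/

theorem T_mem : T ∈ 𝒢 := T'.property

theorem D_mem : D ∈ 𝒢 := D'.property

theorem T_val : T.val = ((1 + Complex.I) / 2) • !![1, 1; 1, -1] := rfl

theorem D_val : D.val = !![1, 0; 0, Complex.I] := rfl

theorem subst_T_x : subst T x = C ((1 + Complex.I) / 2) * (x + y) := by
  simp [x, y, subst_X, T_val, mul_add]

theorem subst_T_y : subst T y = C ((1 + Complex.I) / 2) * (x - y) := by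
  simp [x, y, subst_X, T_val]
  ring

theorem subst_D_x : subst D x = x := by
  simp [x, subst_X, D_val]

theorem subst_D_y : subst D y = C Complex.I * y := by
  simp [y, subst_X, D_val]

theorem C_I_sq : (C Complex.I : MvPolynomial (Fin 2) ℂ) ^ 2 = -1 := by
  rw [← map_pow, Complex.I_sq, map_neg, map_one]

/-- The substitution `f(x, y) ↦ f(ax, by)`. -/
def scale (a b : ℂ) : MvPolynomial (Fin 2) ℂ →ₐ[ℂ] MvPolynomial (Fin 2) ℂ :=
  aeval ![C a * x, C b * y]

theorem coeff_scale (a b : ℂ) (f : MvPolynomial (Fin 2) ℂ) (s : Fin 2 →₀ ℕ) :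
    coeff s (scale a b f) = a ^ s 0 * b ^ s 1 * coeff s f := by
  induction f using MvPolynomial.induction_on' with
  | monomial u c =>
    have h : scale a b (monomial u c) = monomial u (a ^ u 0 * b ^ u 1 * c) := by
      rw [scale, aeval_monomial, monomial_eq, Finsupp.prod_fintype _ _ (by simp),
        Finsupp.prod_fintype _ _ (by simp), Fin.prod_univ_two, Fin.prod_univ_two]
      change C c * ((C a * x) ^ _ * (C b * y) ^ _) = _ * (x ^ _ * y ^ _)
      rw [map_mul, map_mul, map_pow, map_pow]
      ring
    rw [h, coeff_monomial, coeff_monomial]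
    split_ifs with hu
    · rw [hu]
    · rw [mul_zero]
  | add p q hp hq => rw [map_add, coeff_add, coeff_add, hp, hq, mul_add]

theorem subst_D_eq_scale : subst D = scale 1 Complex.I := by
  ext1 i
  fin_cases i
  · exact subst_D_x.trans (by simp [scale])
  · exact subst_D_y.trans (by simp [scale])

theorem coeff_subst_D (f : MvPolynomial (Fin 2) ℂ) (s : Fin 2 →₀ ℕ) :
    coeff s (subst D f) = Complex.I ^ s 1 * coeff s f := by
  rw [subst_D_eq_scale, coeff_scale, one_pow, one_mul]

theorem scale_of_isHomogeneous {f : MvPolynomial (Fin 2) ℂ} {d : ℕ} (hf : f.IsHomogeneous d)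
    (a : ℂ) : scale a a f = C (a ^ d) * f := by
  ext s
  rw [coeff_scale, coeff_C_mul, ← pow_add, ← Fin.sum_univ_two (f := s), ← Finsupp.degree_eq_sum]
  by_cases hs : s.degree = d
  · rw [hs]
  · rw [hf.coeff_eq_zero hs, mul_zero, mul_zero]

theorem isHomogeneous_of_scale {f : MvPolynomial (Fin 2) ℂ} {d : ℕ}
    (h : scale 2 2 f = 2 ^ d * f) : f.IsHomogeneous d := by
  rw [IsHomogeneous, IsWeightedHomogeneous]
  intro s hs
  have h1 := congrArg (coeff s) h
  rw [← map_ofNat C 2, ← map_pow, coeff_C_mul, coeff_scale, ← pow_add,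
    ← Fin.sum_univ_two (f := s), ← Finsupp.degree_eq_sum] at h1
  have hdeg : Finsupp.weight 1 s = s.degree := by
    rw [Finsupp.degree_eq_weight_one]
    rfl
  rw [hdeg]
  have h2 : (2 : ℂ) ^ s.degree = 2 ^ d := mul_right_cancel₀ hs h1
  exact Nat.pow_right_injective le_rfl (by exact_mod_cast h2)

theorem I_pow_eq_I_pow_iff {a b : ℕ} : Complex.I ^ a = Complex.I ^ b ↔ a % 4 = b % 4 := by
  rw [Complex.I_pow_eq_pow_mod a, Complex.I_pow_eq_pow_mod b]
  have ha := Nat.mod_lt a four_pos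
  have hb := Nat.mod_lt b four_pos
  generalize a % 4 = m at *
  generalize b % 4 = n at *
  interval_cases m <;> interval_cases n <;>
    simp [Complex.ext_iff, pow_succ] <;> norm_num

theorem y_pow_dvd_iff {f : MvPolynomial (Fin 2) ℂ} {k : ℕ} :
    y ^ k ∣ f ↔ ∀ s ∈ f.support, k ≤ s 1 := by
  rw [y, X_pow_eq_monomial, monomial_one_dvd_iff_modMonomial_eq_zero]
  constructor
  · intro h s hs
    by_contra hk
    have : coeff s (f.modMonomial (Finsupp.single 1 k)) = coeff s f :=
      coeff_modMonomial_of_not_le _ (by simpa [Finsupp.single_le_iff] using hk)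
    rw [h, coeff_zero] at this
    exact mem_support_iff.1 hs this.symm
  · intro h
    ext s
    by_cases hs : Finsupp.single 1 k ≤ s
    · rw [coeff_modMonomial_of_le _ hs, coeff_zero]
    · rw [coeff_modMonomial_of_not_le _ hs, coeff_zero]
      by_contra hne
      exact hs (by simpa using h s (mem_support_iff.2 hne))

/-- In an eigenvector of `D` for the eigenvalue `iᵉ`, only powers `yⁿ` with `n ≡ e mod 4`
occur. -/
theorem mod_four_of_subst_D {f : MvPolynomial (Fin 2) ℂ} {e : ℕ}
    (h : subst D f = C (Complex.I ^ e) * f) {s : Fin 2 →₀ ℕ} (hs : s ∈ f.support) :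
    s 1 % 4 = e % 4 := by
  have := congrArg (coeff s) h
  rw [coeff_subst_D, coeff_C_mul] at this
  exact I_pow_eq_I_pow_iff.1 (mul_right_cancel₀ (mem_support_iff.1 hs) this)

theorem y_pow_dvd_of_subst_D {f : MvPolynomial (Fin 2) ℂ} {e : ℕ} (he : e < 4)
    (h : subst D f = C (Complex.I ^ e) * f) : y ^ e ∣ f :=
  y_pow_dvd_iff.2 fun _ hs => by
    have := mod_four_of_subst_D h hs
    omega

/-- The linear forms that are proportional to an image of `y` under `𝒢`. Their zero sets are the
mirrors of the reflections in `𝒢`. -/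
def IsMirrorForm (l : MvPolynomial (Fin 2) ℂ) : Prop :=
  ∃ g ∈ 𝒢, ∃ c : ℂ, c ≠ 0 ∧ subst g y = C c * l

theorem isMirrorForm_y : IsMirrorForm y :=
  ⟨1, one_mem _, 1, one_ne_zero, by rw [subst_one, map_one, one_mul]⟩

theorem IsMirrorForm.of_subst {l l' : MvPolynomial (Fin 2) ℂ} (hl : IsMirrorForm l)
    {h : GL (Fin 2) ℂ} (hh : h ∈ 𝒢) {c : ℂ} (hc : c ≠ 0) (hs : subst h l = C c * l') :
    IsMirrorForm l' := by
  obtain ⟨g, hg, a, ha, hga⟩ := hl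
  refine ⟨g * h, mul_mem hg hh, a * c, mul_ne_zero ha hc, ?_⟩
  rw [← subst_subst, hga, map_mul, subst_C, hs, map_mul, mul_assoc]

theorem IsMirrorForm.prime {l : MvPolynomial (Fin 2) ℂ} (hl : IsMirrorForm l) : Prime l := by
  obtain ⟨g, -, c, hc, h⟩ := hl
  have hp := prime_subst_X g (1 : Fin 2)
  change Prime (subst g y) at hp
  rw [h] at hp
  exact ((associated_unit_mul_right l _ ((Ne.isUnit hc).map C)).prime_iff).2 hp

theorem IsMirrorForm.pow_dvd {l f : MvPolynomial (Fin 2) ℂ} (hl : IsMirrorForm l) {k : ℕ}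
    (hf : ∀ g ∈ 𝒢, ∃ c : ℂ, subst g f = C c * f) (hy : y ^ k ∣ f) : l ^ k ∣ f := by
  obtain ⟨g, hg, a, -, hga⟩ := hl
  obtain ⟨c, hc⟩ := hf g hg
  rcases eq_or_ne c 0 with rfl | hc0
  · rw [map_zero, zero_mul, map_eq_zero_iff _ (subst_injective g)] at hc
    exact hc ▸ dvd_zero _
  · have h : (subst g y) ^ k ∣ C c * f := by
      rw [← map_pow, ← hc]
      exact map_dvd _ hy
    rw [hga, mul_pow, ((Ne.isUnit hc0).map C).dvd_mul_left] at h
    exact (dvd_mul_left _ _).trans h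

theorem one_add_I_ne_zero : (1 + Complex.I) ≠ 0 := fun h => by
  simpa using congrArg Complex.re h

theorem isMirrorForm_x_sub_y : IsMirrorForm (x - y) :=
  isMirrorForm_y.of_subst T_mem (div_ne_zero one_add_I_ne_zero two_ne_zero) subst_T_y

theorem isMirrorForm_x_sub_I_mul_y : IsMirrorForm (x - C Complex.I * y) :=
  isMirrorForm_x_sub_y.of_subst D_mem one_ne_zero <| by
    rw [map_sub, subst_D_x, subst_D_y, map_one, one_mul]

theorem isMirrorForm_x_add_y : IsMirrorForm (x + y) :=
  isMirrorForm_x_sub_I_mul_y.of_subst D_mem one_ne_zero <| by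
    rw [map_sub, map_mul, subst_C, subst_D_x, subst_D_y, map_one]
    linear_combination -y * C_I_sq

theorem isMirrorForm_x_add_I_mul_y : IsMirrorForm (x + C Complex.I * y) :=
  isMirrorForm_x_add_y.of_subst D_mem one_ne_zero <| by
    rw [map_add, subst_D_x, subst_D_y, map_one, one_mul]

theorem isMirrorForm_x : IsMirrorForm x :=
  isMirrorForm_x_add_y.of_subst T_mem one_add_I_ne_zero <| by
    have h : (C ((1 + Complex.I) / 2) : MvPolynomial (Fin 2) ℂ) * 2 = C (1 + Complex.I) := by
      rw [← map_ofNat C 2, ← map_mul, div_mul_cancel₀ _ two_ne_zero]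
    rw [map_add, subst_T_x, subst_T_y]
    linear_combination x * h

theorem isRelPrime_of_eval {l l' : MvPolynomial (Fin 2) ℂ} (hl : IsMirrorForm l)
    (p : Fin 2 → ℂ) (h : eval p l = 0) (h' : eval p l' ≠ 0) : IsRelPrime l l' := by
  refine hl.prime.irreducible.isRelPrime_iff_not_dvd.2 fun ⟨q, hq⟩ => h' ?_
  rw [hq, map_mul, h, zero_mul]

/-- The product of the six mirrors of `𝒢`, `-x⁵y + xy⁵`. -/
def mirrorProduct : MvPolynomial (Fin 2) ℂ := -x ^ 5 * y + x * y ^ 5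

/-- A relative invariant of `𝒢` that is divisible by a power of one mirror is divisible by the
same power of the product of all mirrors, because `𝒢` permutes the mirrors transitively. -/
theorem mirrorProduct_pow_dvd {f : MvPolynomial (Fin 2) ℂ} {k : ℕ}
    (hf : ∀ g ∈ 𝒢, ∃ c : ℂ, subst g f = C c * f) (hy : y ^ k ∣ f) : mirrorProduct ^ k ∣ f := by
  let s : Fin 6 → MvPolynomial (Fin 2) ℂ :=
    ![y, x, x - y, x - C Complex.I * y, x + y, x + C Complex.I * y]
  -- a zero of each of the six forms
  let p : Fin 6 → Fin 2 → ℂ :=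
    ![![1, 0], ![0, 1], ![1, 1], ![Complex.I, 1], ![-1, 1], ![-Complex.I, 1]]
  have hs : ∀ i, IsMirrorForm (s i) := by
    intro i
    fin_cases i
    exacts [isMirrorForm_y, isMirrorForm_x, isMirrorForm_x_sub_y, isMirrorForm_x_sub_I_mul_y,
      isMirrorForm_x_add_y, isMirrorForm_x_add_I_mul_y]
  have hprod : mirrorProduct ^ k = (∏ i, s i ^ k) * C (-1) ^ k := by
    rw [Finset.prod_pow, ← mul_pow]
    congr 1
    simp only [s, mirrorProduct, Fin.prod_univ_six]
    simp only [Matrix.cons_val, map_neg, map_one]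
    linear_combination (-x ^ 3 * y ^ 3 + x * y ^ 5) * C_I_sq
  rw [hprod, (((Ne.isUnit (neg_ne_zero.2 one_ne_zero)).map C).pow k).mul_right_dvd]
  refine Fintype.prod_dvd_of_isRelPrime (fun i j hij => ?_) fun i => (hs i).pow_dvd hf hy
  refine (isRelPrime_of_eval (hs i) (p i) ?_ ?_).pow
  · fin_cases i <;> simp [s, p, x, y]
  · fin_cases i <;> fin_cases j <;> first
      | exact absurd rfl hij
      | simp [s, p, x, y, Complex.ext_iff]; done
      | norm_num [s, p, x, y, Complex.ext_iff]

/-! ### The invariant ring -/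

theorem mem_invariantRing_iff {f : MvPolynomial (Fin 2) ℂ} :
    f ∈ invariantRing 𝒢 ↔ subst T f = f ∧ subst D f = f := by
  refine ⟨fun h => ⟨h T T_mem, h D D_mem⟩, fun h g hg => ?_⟩
  induction hg using Subgroup.closure_induction with
  | mem g hg => rcases hg with rfl | rfl; exacts [h.1, h.2]
  | one => exact subst_one f
  | mul a b _ _ ha hb => rw [← subst_subst, ha, hb]
  | inv a _ ha => conv_lhs => rw [← ha, subst_inv_subst]

theorem C_half_one_add_I_pow_four :
    (4 : MvPolynomial (Fin 2) ℂ) * C ((1 + Complex.I) / 2) ^ 4 = -1 := by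
  have h : (4 : ℂ) * ((1 + Complex.I) / 2) ^ 4 = -1 := by
    linear_combination (1 / 4 * Complex.I ^ 2 + Complex.I + 5 / 4) * Complex.I_sq
  rw [← map_ofNat C 4, ← map_pow, ← map_mul, h, map_neg, map_one]

theorem C_I_pow_four : (C Complex.I : MvPolynomial (Fin 2) ℂ) ^ 4 = 1 := by
  rw [← map_pow, Complex.I_pow_four, map_one]

theorem θ_mem : θ ∈ invariantRing 𝒢 := by
  rw [mem_invariantRing_iff]
  have h := C_half_one_add_I_pow_four
  have h' := C_I_pow_four
  simp only [θ, map_add, map_mul, map_pow, map_ofNat, subst_T_x, subst_T_y, subst_D_x, subst_D_y]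
  generalize (C ((1 + Complex.I) / 2) : MvPolynomial (Fin 2) ℂ) = c at *
  generalize (C Complex.I : MvPolynomial (Fin 2) ℂ) = i at *
  constructor
  · linear_combination (x ^ 8 + 14 * x ^ 4 * y ^ 4 + y ^ 8) * (4 * c ^ 4 - 1) * h
  · linear_combination (14 * x ^ 4 * y ^ 4 + y ^ 8 * (i ^ 4 + 1)) * h'

theorem φ_mem : φ ∈ invariantRing 𝒢 := by
  rw [mem_invariantRing_iff]
  have h := C_half_one_add_I_pow_four
  have h' := C_I_pow_four
  simp only [φ, map_add, map_sub, map_mul, map_pow, map_ofNat, subst_T_x, subst_T_y, subst_D_x,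
    subst_D_y]
  generalize (C ((1 + Complex.I) / 2) : MvPolynomial (Fin 2) ℂ) = c at *
  generalize (C Complex.I : MvPolynomial (Fin 2) ℂ) = i at *
  constructor
  · linear_combination -(x ^ 12 - 33 * x ^ 8 * y ^ 4 - 33 * x ^ 4 * y ^ 8 + y ^ 12) *
      (16 * c ^ 8 - 4 * c ^ 4 + 1) * h
  · linear_combination (-33 * x ^ 8 * y ^ 4 - 33 * x ^ 4 * y ^ 8 * (i ^ 4 + 1) +
      y ^ 12 * (i ^ 8 + i ^ 4 + 1)) * h'

theorem isHomogeneous_x : x.IsHomogeneous 1 := isHomogeneous_X _ _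

theorem isHomogeneous_y : y.IsHomogeneous 1 := isHomogeneous_X _ _

theorem isHomogeneous_monomial_xy (c : ℂ) (a b : ℕ) :
    (C c * x ^ a * y ^ b).IsHomogeneous (a + b) := by
  simpa using ((isHomogeneous_x.pow a).C_mul c).mul (isHomogeneous_y.pow b)

theorem isHomogeneous_θ : θ.IsHomogeneous 8 := by
  have h := ((isHomogeneous_monomial_xy 1 8 0).add (isHomogeneous_monomial_xy 14 4 4)).add
    (isHomogeneous_monomial_xy 1 0 8)
  simpa [θ, map_ofNat] using h

theorem isHomogeneous_φ : φ.IsHomogeneous 12 := by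
  have h := (((isHomogeneous_monomial_xy 1 12 0).sub (isHomogeneous_monomial_xy 33 8 4)).sub
    (isHomogeneous_monomial_xy 33 4 8)).add (isHomogeneous_monomial_xy 1 0 12)
  simpa [φ, map_ofNat] using h

theorem isHomogeneous_mirrorProduct : mirrorProduct.IsHomogeneous 6 := by
  have h := (isHomogeneous_monomial_xy (-1) 5 1).add (isHomogeneous_monomial_xy 1 1 5)
  simpa [mirrorProduct] using h

/-- The fourth power of the product of the mirrors is a polynomial in `θ` and `φ`. -/
theorem θ_cube_sub_φ_sq : θ ^ 3 - φ ^ 2 = 108 * mirrorProduct ^ 4 := by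
  simp only [θ, φ, mirrorProduct]
  ring

theorem mirrorProduct_ne_zero : mirrorProduct ≠ 0 := fun h => by
  have := congrArg (eval ![1, 2]) h
  norm_num [mirrorProduct, x, y] at this

theorem C_mul_mirrorProduct_pow_four :
    mirrorProduct ^ 4 = C (1 / 108) * (θ ^ 3 - φ ^ 2) := by
  rw [θ_cube_sub_φ_sq, ← mul_assoc, ← map_ofNat C 108, ← map_mul]
  norm_num

theorem mirrorProduct_pow_four_mem_adjoin :
    mirrorProduct ^ 4 ∈ Algebra.adjoin ℂ ({θ, φ} : Set (MvPolynomial (Fin 2) ℂ)) := by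
  have hθ : θ ∈ Algebra.adjoin ℂ ({θ, φ} : Set (MvPolynomial (Fin 2) ℂ)) :=
    Algebra.subset_adjoin (by simp)
  have hφ : φ ∈ Algebra.adjoin ℂ ({θ, φ} : Set (MvPolynomial (Fin 2) ℂ)) :=
    Algebra.subset_adjoin (by simp)
  rw [C_mul_mirrorProduct_pow_four]
  exact mul_mem (Subalgebra.algebraMap_mem _ _) (sub_mem (pow_mem hθ 3) (pow_mem hφ 2))

theorem adjoin_le_invariantRing :
    Algebra.adjoin ℂ ({θ, φ} : Set (MvPolynomial (Fin 2) ℂ)) ≤ invariantRing 𝒢 :=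
  Algebra.adjoin_le fun f hf => by rcases hf with rfl | rfl; exacts [θ_mem, φ_mem]

theorem eq_single_of_apply_one_eq_zero {f : MvPolynomial (Fin 2) ℂ} {d : ℕ}
    (hf : f.IsHomogeneous d) {s : Fin 2 →₀ ℕ} (hs : s ∈ f.support) (h : s 1 = 0) :
    s = Finsupp.single 0 d := by
  have hdeg : s.degree = d := (hf.degree_eq_sum_deg_support hs).symm
  rw [Finsupp.degree_eq_sum, Fin.sum_univ_two, h, add_zero] at hdeg
  ext i
  fin_cases i
  · simpa using hdeg
  · simpa using h

theorem eval_x_axis {f : MvPolynomial (Fin 2) ℂ} {d : ℕ} (hf : f.IsHomogeneous d) (a : ℂ) :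
    eval ![a, 0] f = coeff (Finsupp.single 0 d) f * a ^ d := by
  rw [eval_eq', Finset.sum_eq_single (Finsupp.single 0 d)]
  · simp [Fin.prod_univ_two]
  · intro s hs hne
    have h1 : s 1 ≠ 0 := fun h => hne (eq_single_of_apply_one_eq_zero hf hs h)
    simp [Fin.prod_univ_two, h1]
  · intro h
    rw [notMem_support_iff.1 h, zero_mul]

/-- An invariant form that vanishes on one mirror vanishes there to order four, the order of the
reflection `D`, and hence is divisible by the fourth power of the product of all mirrors. -/
theorem mirrorProduct_pow_four_dvd {f : MvPolynomial (Fin 2) ℂ} (hf : f ∈ invariantRing 𝒢)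
    {d : ℕ} (hd : f.IsHomogeneous d) (h0 : eval ![1, 0] f = 0) : mirrorProduct ^ 4 ∣ f := by
  refine mirrorProduct_pow_dvd (fun g hg => ⟨1, by rw [hf g hg, map_one, one_mul]⟩)
    (y_pow_dvd_iff.2 fun s hs => ?_)
  have hmod : s 1 % 4 = 0 :=
    mod_four_of_subst_D (e := 0) (by rw [hf D D_mem, pow_zero, map_one, one_mul]) hs
  have h1 : s 1 ≠ 0 := fun h => by
    rw [eval_x_axis hd, one_pow, mul_one, ← eq_single_of_apply_one_eq_zero hd hs h] at h0
    exact mem_support_iff.1 hs h0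
  omega

theorem totalDegree_mirrorProduct_pow_mul {q : MvPolynomial (Fin 2) ℂ} (hq : q ≠ 0) :
    (mirrorProduct ^ 4 * q).totalDegree = 24 + q.totalDegree := by
  rw [totalDegree_mul_of_isDomain (pow_ne_zero 4 mirrorProduct_ne_zero) hq,
    (isHomogeneous_mirrorProduct.pow 4).totalDegree (pow_ne_zero 4 mirrorProduct_ne_zero)]

theorem eq_zero_of_eval_eq_zero_of_degree_lt {f : MvPolynomial (Fin 2) ℂ}
    (hf : f ∈ invariantRing 𝒢) {d : ℕ} (hd : f.IsHomogeneous d) (h0 : eval ![1, 0] f = 0)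
    (hlt : d < 24) : f = 0 := by
  obtain ⟨q, rfl⟩ := mirrorProduct_pow_four_dvd hf hd h0
  by_contra hne
  have hq : q ≠ 0 := right_ne_zero_of_mul hne
  have := hd.totalDegree hne
  rw [totalDegree_mirrorProduct_pow_mul hq] at this
  omega

theorem eval_θ : eval ![1, 0] θ = 1 := by simp [θ, x, y]

theorem eval_φ : eval ![1, 0] φ = 1 := by simp [φ, x, y]

theorem four_dvd_of_eval_ne_zero {f : MvPolynomial (Fin 2) ℂ}
    (hf : f ∈ invariantRing 𝒢) {d : ℕ} (hd : f.IsHomogeneous d) (h0 : eval ![1, 0] f ≠ 0) :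
    4 ∣ d := by
  -- `T ^ 2` is the scalar matrix `i`
  have h : (T * T).val.mulVec ![1, 0] = ![Complex.I, 0] := by
    have h2 : ((1 + Complex.I) / 2) * ((1 + Complex.I) / 2) * 2 = Complex.I := by
      linear_combination (1 / 2) * Complex.I_sq
    rw [Units.val_mul, T_val]
    ext i
    fin_cases i
    · simp
      linear_combination h2
    · simp
  have h1 := eval_subst (T * T) ![1, 0] f
  rw [hf _ (mul_mem T_mem T_mem), h, eval_x_axis hd, eval_x_axis hd] at h1
  rw [eval_x_axis hd, one_pow, mul_one] at h0
  have := I_pow_eq_I_pow_iff.1 ((mul_left_cancel₀ h0 h1).symm.trans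
    ((one_pow d).trans (pow_zero _).symm))
  omega

/-- There is no invariant of degree four: such an `f` with `f(x, 0) = c x⁴` would satisfy
`f² = c²θ` and `f³ = c³φ`, contradicting `θ³ ≠ φ²`. -/
theorem eval_eq_zero_of_degree_four {f : MvPolynomial (Fin 2) ℂ}
    (hf : f ∈ invariantRing 𝒢) (hd : f.IsHomogeneous 4) : eval ![1, 0] f = 0 := by
  set c := eval ![1, 0] f with hc
  have hC (a : ℂ) : C a ∈ invariantRing 𝒢 := (invariantRing 𝒢).algebraMap_mem a
  have h2 : f ^ 2 - C (c ^ 2) * θ = 0 :=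
    eq_zero_of_eval_eq_zero_of_degree_lt
      (sub_mem (pow_mem hf 2) (mul_mem (hC _) θ_mem))
      ((hd.pow 2).sub (isHomogeneous_θ.C_mul _)) (by simp [eval_θ, ← hc]) (by norm_num)
  have h3 : f ^ 3 - C (c ^ 3) * φ = 0 :=
    eq_zero_of_eval_eq_zero_of_degree_lt
      (sub_mem (pow_mem hf 3) (mul_mem (hC _) φ_mem))
      ((hd.pow 3).sub (isHomogeneous_φ.C_mul _)) (by simp [eval_φ, ← hc]) (by norm_num)
  have h : C (c ^ 6) * (108 * mirrorProduct ^ 4) = 0 := by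
    rw [← θ_cube_sub_φ_sq]
    rw [map_pow] at h2 h3 ⊢
    generalize (C c : MvPolynomial (Fin 2) ℂ) = e at *
    linear_combination (-f ^ 4 - f ^ 2 * e ^ 2 * θ - e ^ 4 * θ ^ 2) * h2 + (f ^ 3 + e ^ 3 * φ) * h3
  rcases mul_eq_zero.1 h with h | h
  · rw [map_eq_zero_iff _ (C_injective _ _)] at h
    exact pow_eq_zero_iff (by norm_num) |>.1 h
  · exact absurd h (mul_ne_zero (by norm_num) (pow_ne_zero 4 mirrorProduct_ne_zero))

/-- Every invariant form agrees on the mirror `y = 0` with a form in `θ` and `φ`: both `θ` and `φ`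
are powers of `x` there, and `8a + 12b` takes all multiples of four except four itself. -/
theorem exists_mem_adjoin_eval_eq {f : MvPolynomial (Fin 2) ℂ}
    (hf : f ∈ invariantRing 𝒢) {d : ℕ} (hd : f.IsHomogeneous d) :
    ∃ g ∈ Algebra.adjoin ℂ ({θ, φ} : Set (MvPolynomial (Fin 2) ℂ)), g.IsHomogeneous d ∧
      eval ![1, 0] g = eval ![1, 0] f := by
  by_cases h0 : eval ![1, 0] f = 0
  · exact ⟨0, zero_mem _, isHomogeneous_zero _ _ _, by rw [h0, map_zero]⟩
  have hd4 : d ≠ 4 := by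
    rintro rfl
    exact h0 (eval_eq_zero_of_degree_four hf hd)
  obtain ⟨n, rfl⟩ := four_dvd_of_eval_ne_zero hf hd h0
  obtain ⟨a, b, hab⟩ : ∃ a b, 8 * a + 12 * b = 4 * n := by
    rcases Nat.even_or_odd' n with ⟨m, rfl | rfl⟩
    · exact ⟨m, 0, by omega⟩
    · exact ⟨m - 1, 1, by omega⟩
  refine ⟨C (eval ![1, 0] f) * (θ ^ a * φ ^ b), mul_mem (Subalgebra.algebraMap_mem _ _)
    (mul_mem (pow_mem (Algebra.subset_adjoin (by simp)) a)
      (pow_mem (Algebra.subset_adjoin (by simp)) b)), ?_, by simp [eval_θ, eval_φ]⟩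
  rw [← hab]
  exact ((isHomogeneous_θ.pow a).mul (isHomogeneous_φ.pow b)).C_mul _

theorem homogeneousComponent_mem_invariantRing {n : ℕ} {G : Subgroup (GL (Fin n) ℂ)}
    {f : MvPolynomial (Fin n) ℂ} (hf : f ∈ invariantRing G) (k : ℕ) :
    homogeneousComponent k f ∈ invariantRing G := fun g hg => by
  rw [subst_homogeneousComponent, hf g hg]

theorem mem_adjoin_of_mem_invariantRing (N : ℕ) : ∀ f ∈ invariantRing 𝒢, f.totalDegree < N →
    f ∈ Algebra.adjoin ℂ ({θ, φ} : Set (MvPolynomial (Fin 2) ℂ)) := by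
  induction N with
  | zero => exact fun f _ h => absurd h (Nat.not_lt_zero _)
  | succ N ih =>
    intro f hf hN
    rw [← sum_homogeneousComponent f]
    refine sum_mem fun d hd => ?_
    have hdN : d ≤ N := by
      have := Finset.mem_range.1 hd
      omega
    have hinv := homogeneousComponent_mem_invariantRing hf d
    have hhom := homogeneousComponent_isHomogeneous d f
    generalize homogeneousComponent d f = u at *
    obtain ⟨g, hg, hgd, hgu⟩ := exists_mem_adjoin_eval_eq hinv hhom
    have hsub : u - g ∈ invariantRing 𝒢 := sub_mem hinv (adjoin_le_invariantRing hg)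
    obtain ⟨q, hq⟩ := mirrorProduct_pow_four_dvd hsub (hhom.sub hgd) (by
      rw [map_sub, hgu, sub_self])
    have hu : u = g + mirrorProduct ^ 4 * q := by rw [← hq]; ring
    rw [hu]
    refine add_mem hg (mul_mem mirrorProduct_pow_four_mem_adjoin ?_)
    rcases eq_or_ne q 0 with rfl | hq0
    · exact zero_mem _
    refine ih q (fun a ha => ?_) ?_
    · have hm := adjoin_le_invariantRing mirrorProduct_pow_four_mem_adjoin a ha
      have := hsub a ha
      rw [hq, map_mul, hm] at this
      exact mul_left_cancel₀ (pow_ne_zero 4 mirrorProduct_ne_zero) this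
    · have h1 := (hhom.sub hgd).totalDegree_le
      rw [hq, totalDegree_mirrorProduct_pow_mul hq0] at h1
      omega

theorem invariantRing_eq_adjoin : invariantRing 𝒢 = Algebra.adjoin ℂ {θ, φ} :=
  le_antisymm (fun f hf => mem_adjoin_of_mem_invariantRing _ f hf (Nat.lt_succ_self _))
    adjoin_le_invariantRing

/-- The map `(θ, φ) : ℂ² → ℂ²` is onto. In terms of `p = x⁴ + y⁴` and `q = x⁴y⁴` it is given by
`θ = p² + 12q` and `φ = 4p³ - 3θp`. -/
theorem exists_eval_θ_φ (a b : ℂ) : ∃ v : Fin 2 → ℂ, eval v θ = a ∧ eval v φ = b := by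
  obtain ⟨p, hp⟩ : ∃ p : ℂ, 4 * p ^ 3 - 3 * a * p - b = 0 := by
    let P : Polynomial ℂ := 4 * Polynomial.X ^ 3 - Polynomial.C (3 * a) * Polynomial.X -
      Polynomial.C b
    have hP : P.degree = 3 := by
      have : P = Polynomial.C 4 * Polynomial.X ^ 3 + Polynomial.C 0 * Polynomial.X ^ 2 +
          Polynomial.C (-(3 * a)) * Polynomial.X + Polynomial.C (-b) := by
        simp [P, sub_eq_add_neg, map_ofNat]
      rw [this, Polynomial.degree_cubic (by norm_num)]
    obtain ⟨p, hp⟩ := IsAlgClosed.exists_root P (by rw [hP]; decide)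
    exact ⟨p, by simpa [P, Polynomial.IsRoot] using hp⟩
  obtain ⟨r, hr⟩ := IsAlgClosed.exists_pow_nat_eq (p ^ 2 - 4 * ((a - p ^ 2) / 12)) two_pos
  obtain ⟨u, hu⟩ := IsAlgClosed.exists_pow_nat_eq ((p + r) / 2) four_pos
  obtain ⟨v, hv⟩ := IsAlgClosed.exists_pow_nat_eq ((p - r) / 2) four_pos
  have hu8 : u ^ 8 = ((p + r) / 2) ^ 2 := by rw [← hu]; ring
  have hv8 : v ^ 8 = ((p - r) / 2) ^ 2 := by rw [← hv]; ring
  have hu12 : u ^ 12 = ((p + r) / 2) ^ 3 := by rw [← hu]; ring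
  have hv12 : v ^ 12 = ((p - r) / 2) ^ 3 := by rw [← hv]; ring
  refine ⟨![u, v], ?_, ?_⟩
  · simp only [θ, x, y, map_add, map_mul, map_pow, map_ofNat, eval_X, Matrix.cons_val_zero,
      Matrix.cons_val_one, hu, hv, hu8, hv8]
    linear_combination -3 * hr
  · simp only [φ, x, y, map_add, map_sub, map_mul, map_pow, map_ofNat, eval_X,
      Matrix.cons_val_zero, Matrix.cons_val_one, hu, hv, hu8, hv8, hu12, hv12]
    linear_combination 9 * p * hr + hp

theorem algebraicIndependent_θ_φ : AlgebraicIndependent ℂ ![θ, φ] := by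
  rw [algebraicIndependent_iff]
  intro P hP
  refine MvPolynomial.funext fun w => ?_
  obtain ⟨v, h0, h1⟩ := exists_eval_θ_φ (w 0) (w 1)
  have h : (aeval v).comp (aeval ![θ, φ]) = aeval (R := ℂ) w := by
    ext1 i
    fin_cases i
    · simpa [aeval_eq_eval] using h0
    · simpa [aeval_eq_eval] using h1
  have := DFunLike.congr_fun h P
  rw [AlgHom.comp_apply, hP, map_zero, aeval_eq_eval] at this
  rw [map_zero]
  exact this.symm

/-! ### The order of the group -/

/-- The scalar matrix `i = T²`. -/
def Z : GL (Fin 2) ℂ := T * T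

/-- The matrix `T D² T`, which is `i` times the permutation matrix of the swap. -/
def W : GL (Fin 2) ℂ := T * D ^ 2 * T

theorem half_one_add_I_sq : ((1 + Complex.I) / 2) * ((1 + Complex.I) / 2) = Complex.I / 2 := by
  linear_combination (1 / 4) * Complex.I_sq

theorem Z_val : Z.val = !![Complex.I, 0; 0, Complex.I] := by
  rw [Z, Units.val_mul, T_val, smul_mul_smul, half_one_add_I_sq]
  ext i j
  fin_cases i <;> fin_cases j <;> simp <;> ring

theorem Z_pow_val (a : ℕ) : (Z ^ a).val = !![Complex.I ^ a, 0; 0, Complex.I ^ a] := by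
  induction a with
  | zero => simp [Matrix.one_fin_two]
  | succ a ih => rw [pow_succ, Units.val_mul, ih, Z_val]; simp [pow_succ]

theorem D_pow_val (b : ℕ) : (D ^ b).val = !![1, 0; 0, Complex.I ^ b] := by
  induction b with
  | zero => simp [Matrix.one_fin_two]
  | succ b ih => rw [pow_succ, Units.val_mul, ih, D_val]; simp [pow_succ]

theorem W_val : W.val = !![0, Complex.I; Complex.I, 0] := by
  rw [W, Units.val_mul, Units.val_mul, D_pow_val, T_val, smul_mul_assoc, smul_mul_smul,
    half_one_add_I_sq]
  ext i j
  fin_cases i <;> fin_cases j <;> simp <;> ring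

theorem Z_comm (g : GL (Fin 2) ℂ) : Z * g = g * Z := by
  ext i j
  rw [Units.val_mul, Units.val_mul, Z_val]
  fin_cases i <;> fin_cases j <;> simp [Matrix.mul_apply, Fin.sum_univ_two, mul_comm]

theorem Z_pow_comm (a : ℕ) (g : GL (Fin 2) ℂ) : g * Z ^ a = Z ^ a * g :=
  (Commute.pow_left (Z_comm g) a).eq.symm

theorem Z_pow_four : Z ^ 4 = 1 := by
  ext1
  rw [Z_pow_val, Complex.I_pow_four, Units.val_one, Matrix.one_fin_two]

theorem D_pow_four : D ^ 4 = 1 := by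
  ext1
  rw [D_pow_val, Complex.I_pow_four, Units.val_one, Matrix.one_fin_two]

theorem W_mul_D_pow (b : ℕ) : W * D ^ b = Z ^ b * D ^ (3 * b) * W := by
  have h : Complex.I ^ b * Complex.I ^ (b * 3) = 1 := by
    rw [← pow_add, show b + b * 3 = 4 * b by ring, pow_mul, Complex.I_pow_four, one_pow]
  ext1
  rw [Units.val_mul, Units.val_mul, Units.val_mul, W_val, Z_pow_val, D_pow_val, D_pow_val]
  ext i j
  fin_cases i <;> fin_cases j <;> simp [h, mul_comm]

theorem D_pow_mul_W (b : ℕ) : D ^ b * W = Z ^ b * W * D ^ (3 * b) := by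
  have h : Complex.I ^ b * Complex.I ^ (b * 3) = 1 := by
    rw [← pow_add, show b + b * 3 = 4 * b by ring, pow_mul, Complex.I_pow_four, one_pow]
  ext1
  rw [Units.val_mul, Units.val_mul, Units.val_mul, W_val, Z_pow_val, D_pow_val, D_pow_val]
  ext i j
  fin_cases i <;> fin_cases j <;> simp [mul_comm]
  rw [mul_assoc, h, mul_one]

theorem T_mul_D_mul_T : T * D * T = Z * D ^ 3 * T * D ^ 3 := by
  ext1
  simp only [Units.val_mul, D_val, D_pow_val, T_val, Z_val]
  ext i j
  fin_cases i <;> fin_cases j <;> simp [Complex.ext_iff, pow_succ] <;> norm_num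

theorem T_mul_D_pow_three_mul_T : T * D ^ 3 * T = D * T * D := by
  ext1
  simp only [Units.val_mul, D_val, D_pow_val, T_val]
  ext i j
  fin_cases i <;> fin_cases j <;> simp [Complex.ext_iff, pow_succ] <;> norm_num

/-- A normal form for the elements of `𝒢`: the diagonal matrices, the antidiagonal matrices and
the matrices without zero entries. Only the exponents modulo `4` matter. -/
def normalForm : ℕ × ℕ ⊕ ℕ × ℕ ⊕ ℕ × ℕ × ℕ → GL (Fin 2) ℂ
  | .inl (a, b) => Z ^ a * D ^ b
  | .inr (.inl (a, b)) => Z ^ a * D ^ b * W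
  | .inr (.inr (a, c, b)) => Z ^ a * D ^ c * T * D ^ b

theorem D_mul_normalForm (u) : ∃ v, D * normalForm u = normalForm v := by
  rcases u with ⟨a, b⟩ | ⟨a, b⟩ | ⟨a, c, b⟩
  · refine ⟨.inl (a, b + 1), ?_⟩
    simp only [normalForm, ← mul_assoc, Z_pow_comm, pow_succ' D]
  · refine ⟨.inr (.inl (a, b + 1)), ?_⟩
    simp only [normalForm, ← mul_assoc, Z_pow_comm, pow_succ' D]
  · refine ⟨.inr (.inr (a, c + 1, b)), ?_⟩
    simp only [normalForm, ← mul_assoc, Z_pow_comm, pow_succ' D]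

theorem D_pow_mod (c : ℕ) : D ^ c = D ^ (c % 4) := pow_eq_pow_mod c D_pow_four

theorem Z_pow_mod (c : ℕ) : Z ^ c = Z ^ (c % 4) := pow_eq_pow_mod c Z_pow_four

theorem T_mul_normalForm (u) : ∃ v, T * normalForm u = normalForm v := by
  rcases u with ⟨a, b⟩ | ⟨a, b⟩ | ⟨a, c, b⟩
  · refine ⟨.inr (.inr (a, 0, b)), ?_⟩
    simp only [normalForm, ← mul_assoc, Z_pow_comm, pow_zero, mul_one]
  · refine ⟨.inr (.inr (a + b + 1, 2, 3 * b)), ?_⟩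
    have hTW : T * W = Z * D ^ 2 * T := by simp only [W, Z, ← mul_assoc]
    calc T * (Z ^ a * D ^ b * W) = Z ^ a * T * (D ^ b * W) := by
          rw [← mul_assoc, ← mul_assoc, Z_pow_comm]; simp only [mul_assoc]
      _ = Z ^ a * (T * Z ^ b) * W * D ^ (3 * b) := by rw [D_pow_mul_W]; simp only [mul_assoc]
      _ = Z ^ (a + b) * (T * W) * D ^ (3 * b) := by
          rw [Z_pow_comm, pow_add]; simp only [mul_assoc]
      _ = _ := by rw [hTW]; simp only [normalForm, pow_succ Z, mul_assoc]
  · have h : T * normalForm (.inr (.inr (a, c, b))) = Z ^ a * (T * D ^ (c % 4) * T) * D ^ b := by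
      rw [← D_pow_mod]
      simp only [normalForm, ← mul_assoc, Z_pow_comm]
    rw [h]
    have hc := Nat.mod_lt c four_pos
    generalize c % 4 = m at *
    interval_cases m
    · refine ⟨.inl (a + 1, b), ?_⟩
      simp only [normalForm, pow_zero, mul_one, pow_succ Z]
      rfl
    · refine ⟨.inr (.inr (a + 1, 3, 3 + b)), ?_⟩
      rw [pow_one, T_mul_D_mul_T]
      simp only [normalForm, pow_succ Z, pow_add D, mul_assoc]
    · refine ⟨.inr (.inl (a + b, 3 * b)), ?_⟩
      change Z ^ a * W * D ^ b = _
      rw [mul_assoc, W_mul_D_pow]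
      simp only [normalForm, pow_add Z, mul_assoc]
    · refine ⟨.inr (.inr (a, 1, 1 + b)), ?_⟩
      rw [T_mul_D_pow_three_mul_T]
      simp only [normalForm, pow_add D, pow_one, mul_assoc]

theorem exists_normalForm {g : GL (Fin 2) ℂ} (hg : g ∈ 𝒢) : ∃ u, g = normalForm u := by
  induction hg using Subgroup.closure_induction_left with
  | one => exact ⟨.inl (0, 0), by simp [normalForm]⟩
  | mul_left s hs y _ hy =>
    obtain ⟨u, rfl⟩ := hy
    rcases hs with rfl | rfl
    exacts [T_mul_normalForm u, D_mul_normalForm u]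
  | inv_mul_cancel s hs y _ hy =>
    obtain ⟨u, rfl⟩ := hy
    -- the inverse of a generator is a positive power of it
    have hpow : ∀ (t : GL (Fin 2) ℂ), (∀ u, ∃ v, t * normalForm u = normalForm v) →
        ∀ (k : ℕ) (u), ∃ v, t ^ k * normalForm u = normalForm v := by
      intro t ht k
      induction k with
      | zero => exact fun u => ⟨u, by rw [pow_zero, one_mul]⟩
      | succ k ih =>
        intro u
        obtain ⟨v, hv⟩ := ht u
        obtain ⟨w, hw⟩ := ih v
        exact ⟨w, by rw [pow_succ, mul_assoc, hv, hw]⟩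
    rcases hs with rfl | rfl
    · have hT : T⁻¹ = T ^ 7 := by
        rw [inv_eq_iff_mul_eq_one, ← pow_succ', show 7 + 1 = 2 * 4 from rfl, pow_mul, pow_two]
        exact Z_pow_four
      rw [hT]
      exact hpow T T_mul_normalForm 7 u
    · have hD : D⁻¹ = D ^ 3 := by
        rw [inv_eq_iff_mul_eq_one, ← pow_succ']
        exact D_pow_four
      rw [hD]
      exact hpow D D_mul_normalForm 3 u

/-- The normal form with exponents between `0` and `3`. -/
def reducedNormalForm :
    Fin 4 × Fin 4 ⊕ Fin 4 × Fin 4 ⊕ Fin 4 × Fin 4 × Fin 4 → GL (Fin 2) ℂ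
  | .inl (a, b) => normalForm (.inl (a, b))
  | .inr (.inl (a, b)) => normalForm (.inr (.inl (a, b)))
  | .inr (.inr (a, c, b)) => normalForm (.inr (.inr (a, c, b)))

theorem exists_reducedNormalForm (u) : ∃ v, normalForm u = reducedNormalForm v := by
  let r (a : ℕ) : Fin 4 := ⟨a % 4, Nat.mod_lt a four_pos⟩
  rcases u with ⟨a, b⟩ | ⟨a, b⟩ | ⟨a, c, b⟩
  · refine ⟨.inl (r a, r b), ?_⟩
    simp only [normalForm, reducedNormalForm]
    rw [Z_pow_mod a, D_pow_mod b]
  · refine ⟨.inr (.inl (r a, r b)), ?_⟩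
    simp only [normalForm, reducedNormalForm]
    rw [Z_pow_mod a, D_pow_mod b]
  · refine ⟨.inr (.inr (r a, r c, r b)), ?_⟩
    simp only [normalForm, reducedNormalForm]
    rw [Z_pow_mod a, D_pow_mod b, D_pow_mod c]

theorem reducedNormalForm_mem (u) : reducedNormalForm u ∈ 𝒢 := by
  have hZ : Z ∈ 𝒢 := mul_mem T_mem T_mem
  have hW : W ∈ 𝒢 := mul_mem (mul_mem T_mem (pow_mem D_mem 2)) T_mem
  rcases u with ⟨a, b⟩ | ⟨a, b⟩ | ⟨a, c, b⟩
  · exact mul_mem (pow_mem hZ _) (pow_mem D_mem _)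
  · exact mul_mem (mul_mem (pow_mem hZ _) (pow_mem D_mem _)) hW
  · exact mul_mem (mul_mem (mul_mem (pow_mem hZ _) (pow_mem D_mem _)) T_mem) (pow_mem D_mem _)

theorem eq_of_I_pow_eq {a b : Fin 4} (h : Complex.I ^ (a : ℕ) = Complex.I ^ (b : ℕ)) : a = b := by
  have := I_pow_eq_I_pow_iff.1 h
  omega

theorem reducedNormalForm_val_diagonal (a b : Fin 4) :
    (reducedNormalForm (.inl (a, b))).val =
      !![Complex.I ^ (a : ℕ), 0; 0, Complex.I ^ (a : ℕ) * Complex.I ^ (b : ℕ)] := by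
  simp only [reducedNormalForm, normalForm, Units.val_mul, Z_pow_val, D_pow_val]
  simp

theorem reducedNormalForm_val_antidiagonal (a b : Fin 4) :
    (reducedNormalForm (.inr (.inl (a, b)))).val =
      !![0, Complex.I ^ (a : ℕ) * Complex.I;
        Complex.I ^ (a : ℕ) * Complex.I ^ (b : ℕ) * Complex.I, 0] := by
  simp only [reducedNormalForm, normalForm, Units.val_mul, Z_pow_val, D_pow_val, W_val]
  simp

theorem reducedNormalForm_val_full (a c b : Fin 4) :
    (reducedNormalForm (.inr (.inr (a, c, b)))).val =
      !![Complex.I ^ (a : ℕ) * ((1 + Complex.I) / 2),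
        Complex.I ^ (a : ℕ) * ((1 + Complex.I) / 2) * Complex.I ^ (b : ℕ);
        Complex.I ^ (a : ℕ) * ((1 + Complex.I) / 2) * Complex.I ^ (c : ℕ),
        -(Complex.I ^ (a : ℕ) * ((1 + Complex.I) / 2) * Complex.I ^ (c : ℕ) *
          Complex.I ^ (b : ℕ))] := by
  simp only [reducedNormalForm, normalForm, Units.val_mul, Z_pow_val, D_pow_val, T_val]
  ext i j
  fin_cases i <;> fin_cases j <;> simp <;> ring

theorem reducedNormalForm_injective : Function.Injective reducedNormalForm := by
  have hI : ∀ n : ℕ, Complex.I ^ n ≠ 0 := fun n => pow_ne_zero n Complex.I_ne_zero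
  have hw : (1 + Complex.I) / 2 ≠ 0 := div_ne_zero one_add_I_ne_zero two_ne_zero
  intro u v h
  have hval := congrArg Units.val h
  have h00 := congrFun₂ hval 0 0
  have h01 := congrFun₂ hval 0 1
  have h10 := congrFun₂ hval 1 0
  have h11 := congrFun₂ hval 1 1
  rcases u with ⟨a, b⟩ | ⟨a, b⟩ | ⟨a, c, b⟩ <;> rcases v with ⟨a', b'⟩ | ⟨a', b'⟩ | ⟨a', c', b'⟩ <;>
    simp only [reducedNormalForm_val_diagonal, reducedNormalForm_val_antidiagonal,
      reducedNormalForm_val_full, Matrix.of_apply, Matrix.cons_val', Matrix.cons_val_zero,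
      Matrix.cons_val_one, Matrix.cons_val_fin_one] at h00 h01 h10 h11
  · obtain rfl := eq_of_I_pow_eq h00
    obtain rfl := eq_of_I_pow_eq (mul_left_cancel₀ (hI _) h11)
    rfl
  · exact absurd h00 (hI _)
  · exact absurd h01.symm (mul_ne_zero (mul_ne_zero (hI _) hw) (hI _))
  · exact absurd h00.symm (hI _)
  · obtain rfl := eq_of_I_pow_eq (mul_right_cancel₀ Complex.I_ne_zero h01)
    obtain rfl := eq_of_I_pow_eq (mul_left_cancel₀ (hI _) (mul_right_cancel₀ Complex.I_ne_zero h10))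
    rfl
  · exact absurd h00.symm (mul_ne_zero (hI _) hw)
  · exact absurd h01 (mul_ne_zero (mul_ne_zero (hI _) hw) (hI _))
  · exact absurd h00 (mul_ne_zero (hI _) hw)
  · obtain rfl := eq_of_I_pow_eq (mul_right_cancel₀ hw h00)
    obtain rfl := eq_of_I_pow_eq (mul_left_cancel₀ (mul_ne_zero (hI _) hw) h01)
    obtain rfl := eq_of_I_pow_eq (mul_left_cancel₀ (mul_ne_zero (hI _) hw) h10)
    rfl

theorem card_𝒢 : Nat.card 𝒢 = 96 := by
  have hb : Function.Bijective fun u => (⟨reducedNormalForm u, reducedNormalForm_mem u⟩ : 𝒢) := by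
    refine ⟨fun u v h => reducedNormalForm_injective (congrArg Subtype.val h), fun g => ?_⟩
    obtain ⟨u, hu⟩ := exists_normalForm g.property
    obtain ⟨v, hv⟩ := exists_reducedNormalForm u
    exact ⟨v, Subtype.ext (hu.trans hv).symm⟩
  rw [← Nat.card_eq_of_bijective _ hb]
  simp

/-! ### Representations generated by a vector of polynomials -/

theorem linearIndependent_of_subst_D {m : ℕ} {F : Fin m → MvPolynomial (Fin 2) ℂ}
    {d : Fin m → ℂ} (hd : Function.Injective d) (h0 : ∀ i, F i ≠ 0)
    (hD : ∀ i, subst D (F i) = C (d i) * F i) : LinearIndependent ℂ F :=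
  Module.End.eigenvectors_linearIndependent' (subst D).toLinearMap d hd F fun i =>
    Module.End.hasEigenvector_iff.2 ⟨Module.End.mem_eigenspace_iff.2 <| by
      rw [AlgHom.toLinearMap_apply, hD, smul_eq_C_mul], h0 i⟩

theorem matMulVec_injective {n m : ℕ} {F : Fin m → MvPolynomial (Fin n) ℂ}
    (hF : LinearIndependent ℂ F) {M N : Matrix (Fin m) (Fin m) ℂ}
    (h : matMulVec M F = matMulVec N F) : M = N := by
  ext i j
  have hi := congrFun h i
  simp only [matMulVec, Matrix.mulVec, dotProduct, Matrix.map_apply] at hi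
  refine sub_eq_zero.1 (Fintype.linearIndependent_iff.1 hF (fun j => M i j - N i j) ?_ j)
  simp only [smul_eq_C_mul, map_sub, sub_mul, Finset.sum_sub_distrib, hi, sub_self]

theorem matMulVec_mul {n m : ℕ} (M N : Matrix (Fin m) (Fin m) ℂ)
    (F : Fin m → MvPolynomial (Fin n) ℂ) :
    matMulVec (M * N) F = matMulVec M (matMulVec N F) := by
  simp only [matMulVec, Matrix.mulVec_mulVec, Matrix.map_mul]

theorem matMulVec_one {n m : ℕ} (F : Fin m → MvPolynomial (Fin n) ℂ) : matMulVec 1 F = F := by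
  rw [matMulVec, Matrix.map_one _ (map_zero C) (map_one C), Matrix.one_mulVec]

theorem subst_matMulVec {n m : ℕ} (g : GL (Fin n) ℂ) (M : Matrix (Fin m) (Fin m) ℂ)
    (F : Fin m → MvPolynomial (Fin n) ℂ) :
    (fun i => subst g (matMulVec M F i)) = matMulVec M fun i => subst g (F i) := by
  funext i
  simp [matMulVec, Matrix.mulVec, dotProduct]

/-- If the entries of `F` are linearly independent and their span is stable under the generators
of `𝒢`, then `F(g x) = ρ(g) F(x)` defines a representation `ρ` of `𝒢`. -/
theorem exists_representation {m : ℕ} {F : Fin m → MvPolynomial (Fin 2) ℂ}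
    (hF : LinearIndependent ℂ F) {A B : Matrix (Fin m) (Fin m) ℂ}
    (hT : (fun i => subst T (F i)) = matMulVec A F)
    (hD : (fun i => subst D (F i)) = matMulVec B F) :
    ∃ ρ : 𝒢 →* GL (Fin m) ℂ, HasValues ρ A B := by
  have hmul : ∀ (a b : GL (Fin 2) ℂ) (M N : Matrix (Fin m) (Fin m) ℂ),
      (fun i => subst a (F i)) = matMulVec M F → (fun i => subst b (F i)) = matMulVec N F →
      (fun i => subst (a * b) (F i)) = matMulVec (M * N) F := by
    intro a b M N ha hb
    simp only [← subst_subst]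
    rw [matMulVec_mul, ← hb, ← subst_matMulVec, ← ha]
  have hex : ∀ g ∈ 𝒢, ∃ M, (fun i => subst g (F i)) = matMulVec M F := by
    intro g hg
    induction hg using Subgroup.closure_induction with
    | mem g hg => rcases hg with rfl | rfl; exacts [⟨A, hT⟩, ⟨B, hD⟩]
    | one => exact ⟨1, by simp [subst_one, matMulVec_one]⟩
    | mul a b _ _ ha hb =>
      obtain ⟨M, hM⟩ := ha
      obtain ⟨N, hN⟩ := hb
      exact ⟨M * N, hmul a b M N hM hN⟩
    | inv a ha h =>
      obtain ⟨M, hM⟩ := h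
      have hpow : ∀ n, (fun i => subst (a ^ n) (F i)) = matMulVec (M ^ n) F := by
        intro n
        induction n with
        | zero => simp [subst_one, matMulVec_one]
        | succ n ih => rw [pow_succ, pow_succ]; exact hmul _ _ _ _ ih hM
      -- the group is finite, so the inverse is a positive power
      have hinv : a⁻¹ = a ^ 95 := by
        rw [inv_eq_iff_mul_eq_one, ← pow_succ']
        have := pow_card_eq_one' (x := (⟨a, ha⟩ : 𝒢))
        rw [card_𝒢] at this
        exact congrArg Subtype.val this
      exact ⟨M ^ 95, by rw [hinv]; exact hpow 95⟩
  choose M hM using fun g : 𝒢 => hex g.val g.property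
  let r : 𝒢 →* Matrix (Fin m) (Fin m) ℂ :=
    { toFun := M
      map_one' := matMulVec_injective hF <| by
        rw [← hM, matMulVec_one]
        funext i
        exact subst_one _
      map_mul' := fun a b => matMulVec_injective hF <| by
        rw [← hM]
        exact hmul _ _ _ _ (hM a) (hM b) }
  exact ⟨r.toHomUnits, matMulVec_injective hF ((hM T').symm.trans hT),
    matMulVec_injective hF ((hM D').symm.trans hD)⟩

theorem mem_vectorInvariants_iff {m : ℕ} (ρ : 𝒢 →* GL (Fin m) ℂ)
    {A B : Matrix (Fin m) (Fin m) ℂ} (hρ : HasValues ρ A B)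
    {F : Fin m → MvPolynomial (Fin 2) ℂ} :
    F ∈ vectorInvariants ρ ↔ (fun i => subst T (F i)) = matMulVec A F ∧
      (fun i => subst D (F i)) = matMulVec B F := by
  constructor
  · intro h
    rw [← hρ.1, ← hρ.2]
    exact ⟨h T', h D'⟩
  · rintro ⟨hT, hD⟩ ⟨g, hg⟩
    induction hg using Subgroup.closure_induction with
    | mem g hg =>
      rcases hg with rfl | rfl
      · exact hT.trans (by rw [← hρ.1]; rfl)
      · exact hD.trans (by rw [← hρ.2]; rfl)
    | one =>
      change _ = matMulVec (ρ 1).val F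
      rw [map_one, Units.val_one, matMulVec_one]
      funext i
      exact subst_one _
    | mul a b ha hb iha ihb =>
      change _ = matMulVec (ρ (⟨a, ha⟩ * ⟨b, hb⟩)).val F
      rw [map_mul, Units.val_mul, matMulVec_mul, ← ihb, ← subst_matMulVec, ← iha]
      funext i
      exact (subst_subst _ _ _).symm
    | inv a ha iha =>
      change _ = matMulVec (ρ (⟨a, ha⟩⁻¹)).val F
      have h := congrArg (fun G => matMulVec (ρ (⟨a, ha⟩⁻¹)).val fun i => subst a⁻¹ (G i)) iha
      simp only [subst_matMulVec, ← matMulVec_mul, ← Units.val_mul, ← map_mul,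
        inv_mul_cancel, map_one, Units.val_one, matMulVec_one, subst_inv_subst] at h
      exact h.symm

/-! ### Irreducibility -/

theorem single_mem_of_diagonal {m : ℕ} {W : Submodule ℂ (Fin m → ℂ)} {d : Fin m → ℂ}
    (hd : Function.Injective d) (hW : ∀ v ∈ W, (Matrix.diagonal d).mulVec v ∈ W)
    {v : Fin m → ℂ} (hv : v ∈ W) {j : Fin m} (hj : v j ≠ 0) : Pi.single j 1 ∈ W := by
  have hP : ∀ P : Polynomial ℂ, (fun i => P.eval (d i) * v i) ∈ W := by
    intro P
    induction P using Polynomial.induction_on' with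
    | add p q hp hq =>
      convert W.add_mem hp hq using 1
      funext i
      simp [add_mul]
    | monomial n a =>
      have hn : (fun i => d i ^ n * v i) ∈ W := by
        induction n with
        | zero => simpa using hv
        | succ n ih =>
          convert hW _ ih using 1
          funext i
          rw [Matrix.mulVec_diagonal]
          ring
      convert W.smul_mem a hn using 1
      funext i
      simp [mul_assoc]
  convert W.smul_mem (v j)⁻¹ (hP (Lagrange.basis Finset.univ d j)) using 1
  funext i
  rcases eq_or_ne i j with rfl | hij
  · simp [Lagrange.eval_basis_self hd.injOn, hj]
  · simp [Lagrange.eval_basis_of_ne hij.symm (Finset.mem_univ i), hij]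

/-- A stable subspace is spanned by basis vectors, because `D` acts with distinct eigenvalues.
If it contains one of them then, applying `T`, it contains the `k`-th one and hence all. -/
theorem isIrreducible_of_diagonal {m : ℕ} {ρ : 𝒢 →* GL (Fin m) ℂ}
    {A : Matrix (Fin m) (Fin m) ℂ} {d : Fin m → ℂ} (hρ : HasValues ρ A (Matrix.diagonal d))
    (hd : Function.Injective d) (k : Fin m) (hcol : ∀ i, A i k ≠ 0) (hrow : ∀ i, A k i ≠ 0) :
    (linearRep ρ).IsIrreducible := by
  have hT : ∀ (W : Subrepresentation (linearRep ρ)), ∀ v ∈ W.toSubmodule,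
      A.mulVec v ∈ W.toSubmodule := fun W v hv => by
    rw [← hρ.1]
    exact W.apply_mem_toSubmodule T' hv
  have hD : ∀ (W : Subrepresentation (linearRep ρ)), ∀ v ∈ W.toSubmodule,
      (Matrix.diagonal d).mulVec v ∈ W.toSubmodule := fun W v hv => by
    rw [← hρ.2]
    exact W.apply_mem_toSubmodule D' hv
  refine { exists_pair_ne := ⟨⊥, ⊤, fun h => ?_⟩, eq_bot_or_eq_top := fun W => ?_ }
  · have h1 : (⊥ : Submodule ℂ (Fin m → ℂ)) = ⊤ :=
      congrArg Subrepresentation.toSubmodule h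
    have h2 : (Pi.single k 1 : Fin m → ℂ) ∈ (⊥ : Submodule ℂ (Fin m → ℂ)) := by
      rw [h1]; trivial
    simpa using congrFun ((Submodule.mem_bot ℂ).1 h2) k
  · rw [or_iff_not_imp_left]
    intro hW
    have hW' : W.toSubmodule ≠ ⊥ := fun h =>
      hW (Subrepresentation.toSubmodule_injective h)
    obtain ⟨v, hv, hv0⟩ := Submodule.exists_mem_ne_zero_of_ne_bot hW'
    obtain ⟨j, hj⟩ := Function.ne_iff.1 hv0
    have hj1 := single_mem_of_diagonal hd (hD W) hv hj
    have hk1 : Pi.single k 1 ∈ W.toSubmodule :=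
      single_mem_of_diagonal hd (hD W) (hT W _ hj1) (j := k) (by simpa using hrow j)
    have hall : ∀ i, Pi.single i 1 ∈ W.toSubmodule := fun i =>
      single_mem_of_diagonal hd (hD W) (hT W _ hk1) (j := i) (by simpa using hcol i)
    apply Subrepresentation.toSubmodule_injective
    change W.toSubmodule = ⊤
    rw [eq_top_iff]
    intro w _
    rw [pi_eq_sum_univ' w]
    exact sum_mem fun i _ => W.toSubmodule.smul_mem _ (hall i)

/-! ### Freeness -/

theorem subst_det {m : ℕ} {ρ : 𝒢 →* GL (Fin m) ℂ}
    {N : Matrix (Fin m) (Fin m) (MvPolynomial (Fin 2) ℂ)}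
    (hN : ∀ j, (fun i => N i j) ∈ vectorInvariants ρ) (g : 𝒢) :
    subst g.val N.det = C (ρ g).val.det * N.det := by
  have h : (subst g.val).mapMatrix N = (ρ g).val.map C * N := by
    ext1 i j
    exact congrFun (hN j g) i
  rw [AlgHom.map_det, h, Matrix.det_mul, RingHom.map_det, RingHom.mapMatrix_apply]

/-- If `ρ(D)` is diagonal with entries `i ^ (e k)`, then the `k`-th row of a matrix with columns in
`M(ρ)` is divisible by `y ^ (e k)`. Hence the determinant, being a relative invariant, is divisible
by the corresponding power of the product of the mirrors. -/
theorem mirrorProduct_pow_dvd_det {m : ℕ} {ρ : 𝒢 →* GL (Fin m) ℂ} {A : Matrix (Fin m) (Fin m) ℂ}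
    {e : Fin m → ℕ} (he : ∀ i, e i < 4)
    (hρ : HasValues ρ A (Matrix.diagonal fun i => Complex.I ^ e i))
    {N : Matrix (Fin m) (Fin m) (MvPolynomial (Fin 2) ℂ)}
    (hN : ∀ j, (fun i => N i j) ∈ vectorInvariants ρ) :
    mirrorProduct ^ (∑ i, e i) ∣ N.det := by
  refine mirrorProduct_pow_dvd (fun g hg => ⟨_, subst_det hN ⟨g, hg⟩⟩) ?_
  have hrow : ∀ i j, y ^ e i ∣ N i j := fun i j => y_pow_dvd_of_subst_D (he i) <| by
    have h := congrFun ((mem_vectorInvariants_iff ρ hρ).1 (hN j)).2 i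
    rwa [matMulVec, Matrix.diagonal_map (map_zero C), Matrix.mulVec_diagonal] at h
  choose Q hQ using hrow
  have h : N = Matrix.of fun i j => y ^ e i * (Matrix.of Q) i j := by
    ext1 i j
    exact hQ i j
  rw [h, Matrix.det_mul_column, Finset.prod_pow_eq_pow_sum]
  exact dvd_mul_right _ _

/-- A shortcut for instance search. -/
instance {n m : ℕ} {G : Subgroup (GL (Fin n) ℂ)} (ρ : G →* GL (Fin m) ℂ) :
    SMul (invariantRing G) (vectorInvariants ρ) :=
  (vectorInvariants ρ).module.toSMul

theorem sum_smul_apply {m r : ℕ} {G : Subgroup (GL (Fin m) ℂ)} {n : ℕ} {ρ : G →* GL (Fin n) ℂ}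
    {F : Fin r → Fin n → MvPolynomial (Fin m) ℂ} (hF : ∀ j, F j ∈ vectorInvariants ρ)
    (c : Fin r → invariantRing G) :
    ((∑ j, c j • (⟨F j, hF j⟩ : vectorInvariants ρ) : vectorInvariants ρ) :
      Fin n → MvPolynomial (Fin m) ℂ) = (Matrix.of F).transpose.mulVec fun j => (c j).val := by
  funext i
  simp only [AddSubmonoidClass.coe_finsetSum, Finset.sum_apply, Matrix.mulVec, dotProduct]
  exact Finset.sum_congr rfl fun j _ => mul_comm _ _

/-- Freeness criterion: elements of `M(ρ)` whose determinant has no more zeros than forced by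
`mirrorProduct_pow_dvd_det` form a basis. By Cramer's rule the coordinates of an element of `M(ρ)`
are quotients of such determinants, hence polynomials, and they are invariant. -/
theorem isFreeOn_of_det {m : ℕ} {ρ : 𝒢 →* GL (Fin m) ℂ} {A : Matrix (Fin m) (Fin m) ℂ}
    {e : Fin m → ℕ} (he : ∀ i, e i < 4)
    (hρ : HasValues ρ A (Matrix.diagonal fun i => Complex.I ^ e i))
    {F : Fin m → Fin m → MvPolynomial (Fin 2) ℂ} (hF : ∀ j, F j ∈ vectorInvariants ρ)
    {c : ℂ} (hc : c ≠ 0) (hdet : (Matrix.of F).det = C c * mirrorProduct ^ (∑ i, e i)) :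
    IsFreeOn ρ F := by
  set N := (Matrix.of F).transpose with hNdef
  have hN : ∀ j, (fun i => N i j) ∈ vectorInvariants ρ := hF
  have hNdet : N.det = C c * mirrorProduct ^ (∑ i, e i) := by
    rw [hNdef, Matrix.det_transpose, hdet]
  have hN0 : N.det ≠ 0 := by
    rw [hNdet]
    exact mul_ne_zero ((map_ne_zero_iff _ (C_injective _ _)).2 hc)
      (pow_ne_zero _ mirrorProduct_ne_zero)
  have hli : LinearIndependent (invariantRing 𝒢)
      fun j => (⟨F j, hF j⟩ : vectorInvariants ρ) := by
    refine Fintype.linearIndependent_iffₛ.2 fun a b hab j => Subtype.ext ?_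
    have h := congrArg Subtype.val hab
    rw [sum_smul_apply, sum_smul_apply, ← sub_eq_zero, ← Matrix.mulVec_sub] at h
    exact sub_eq_zero.1 (congrFun (Matrix.eq_zero_of_mulVec_eq_zero hN0 h) j)
  have hsp : ⊤ ≤ Submodule.span (invariantRing 𝒢)
      (Set.range fun j => (⟨F j, hF j⟩ : vectorInvariants ρ)) := by
    rintro ⟨V, hV⟩ -
    have hdvd : ∀ j, N.det ∣ N.cramer V j := by
      intro j
      rw [hNdet, ((Ne.isUnit hc).map C).mul_left_dvd, Matrix.cramer_apply]
      refine mirrorProduct_pow_dvd_det he hρ fun k => ?_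
      rcases eq_or_ne k j with rfl | hk
      · simpa using hV
      · simpa [Matrix.updateCol_ne hk] using hN k
    choose q hq using hdvd
    have hq' : N.cramer V = N.det • q := funext hq
    have hVq : N.mulVec q = V := by
      have h := N.mulVec_cramer V
      rw [hq', Matrix.mulVec_smul] at h
      exact smul_right_injective _ hN0 h
    -- applying `g` to `V = ∑ qⱼ Fⱼ` shows that the `g qⱼ` are coordinates of `V` as well
    have hinv : ∀ j, q j ∈ invariantRing 𝒢 := by
      intro j g hg
      have h1 : N.mulVec (fun j => subst g (q j)) = V := by
        have h2 : (fun i => subst g (V i)) =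
            matMulVec (ρ ⟨g, hg⟩).val (N.mulVec fun j => subst g (q j)) := by
          rw [matMulVec, Matrix.mulVec_mulVec, ← hVq]
          funext i
          simp only [Matrix.mulVec, dotProduct, map_sum, map_mul]
          exact Finset.sum_congr rfl fun k _ => congrArg (· * _) (congrFun (hN k ⟨g, hg⟩) i)
        have h3 := congrArg (matMulVec (ρ ⟨g, hg⟩⁻¹).val) (h2.symm.trans (hV ⟨g, hg⟩))
        simpa only [← matMulVec_mul, ← Units.val_mul, ← map_mul, inv_mul_cancel, map_one,
          Units.val_one, matMulVec_one] using h3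
      have h4 := Matrix.eq_zero_of_mulVec_eq_zero hN0
        (v := (fun j => subst g (q j)) - q) (by rw [Matrix.mulVec_sub, h1, hVq, sub_self])
      exact sub_eq_zero.1 (congrFun h4 j)
    have hsum : (⟨V, hV⟩ : vectorInvariants ρ) =
        ∑ j, (⟨q j, hinv j⟩ : invariantRing 𝒢) • (⟨F j, hF j⟩ : vectorInvariants ρ) :=
      Subtype.ext <| by rw [sum_smul_apply]; exact hVq.symm
    rw [hsum]
    exact sum_mem fun j _ => Submodule.smul_mem _ _ (Submodule.subset_span ⟨j, rfl⟩)
  exact ⟨Module.Basis.mk hli hsp, fun j => by rw [Module.Basis.mk_apply]⟩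

/-! ### Hilbert series -/

/-- The generating function of the number of elements of given degree in a graded set. -/
def countingSeries {ι : Type*} (deg : ι → ℕ) : PowerSeries ℚ :=
  PowerSeries.mk fun k => (Nat.card {i // deg i = k} : ℚ)

theorem finite_fiber_prod {ι : Type*} {deg : ι → ℕ} (hfin : ∀ k, Finite {i // deg i = k}) {n : ℕ}
    (hn : 0 < n) (k : ℕ) : Finite {p : ι × ℕ // deg p.1 + n * p.2 = k} := by
  have h : ((⋃ l ∈ Set.Iic k, {i | deg i = l}) ×ˢ Set.Iic k).Finite :=
    ((Set.finite_Iic k).biUnion fun l _ => hfin l).prod (Set.finite_Iic k)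
  refine (h.subset fun p hp => ⟨?_, ?_⟩ : Set.Finite {p : ι × ℕ | deg p.1 + n * p.2 = k})
  · simp only [Set.mem_iUnion, Set.mem_ofPred_eq, Set.mem_Iic] at hp ⊢
    exact ⟨deg p.1, by omega, rfl⟩
  · simp only [Set.mem_ofPred_eq, Set.mem_Iic] at hp ⊢
    have := Nat.le_mul_of_pos_left p.2 hn
    omega

/-- Adjoining a free variable of degree `n` divides the counting series by `1 - tⁿ`. -/
theorem countingSeries_prod {ι : Type*} {deg : ι → ℕ} (hfin : ∀ k, Finite {i // deg i = k})
    {n : ℕ} (hn : 0 < n) :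
    countingSeries (fun p : ι × ℕ => deg p.1 + n * p.2) * (1 - PowerSeries.X ^ n) =
      countingSeries deg := by
  ext k
  rw [mul_sub, mul_one, map_sub, PowerSeries.coeff_mul_X_pow', sub_eq_iff_eq_add]
  simp only [countingSeries, PowerSeries.coeff_mk]
  have := hfin k
  -- split off the elements with exponent zero
  let e : {p : ι × ℕ // deg p.1 + n * p.2 = k} ≃
      {i // deg i = k} ⊕ {p : ι × ℕ // deg p.1 + n * (p.2 + 1) = k} :=
    { toFun := fun p => match p with
        | ⟨(i, 0), h⟩ => .inl ⟨i, by simpa using h⟩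
        | ⟨(i, a + 1), h⟩ => .inr ⟨(i, a), h⟩
      invFun := fun s => match s with
        | .inl i => ⟨(i.val, 0), by simpa using i.property⟩
        | .inr p => ⟨(p.val.1, p.val.2 + 1), p.property⟩
      left_inv := by rintro ⟨⟨i, _ | a⟩, h⟩ <;> rfl
      right_inv := by rintro (i | p) <;> rfl }
  split_ifs with hk
  · have hfin' := finite_fiber_prod hfin hn (k - n)
    have heq : ∀ p : ι × ℕ, deg p.1 + n * (p.2 + 1) = k ↔ deg p.1 + n * p.2 = k - n := by
      intro p
      rw [mul_add, mul_one]
      omega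
    let e' := Equiv.subtypeEquivRight heq
    have : Finite {p : ι × ℕ // deg p.1 + n * (p.2 + 1) = k} := Finite.of_equiv _ e'.symm
    rw [Nat.card_congr e, Nat.card_sum, Nat.card_congr e', Nat.cast_add]
  · have hempty : IsEmpty {p : ι × ℕ // deg p.1 + n * (p.2 + 1) = k} := ⟨fun p => by
      have := p.property
      rw [mul_add, mul_one] at this
      omega⟩
    rw [Nat.card_congr e, Nat.card_sum, Nat.card_eq_zero.2 (.inl hempty), add_zero, add_zero]

theorem countingSeries_fintype {ι : Type*} [Fintype ι] (d : ι → ℕ) :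
    countingSeries d = ∑ j, PowerSeries.X ^ d j := by
  ext k
  simp only [countingSeries, PowerSeries.coeff_mk, map_sum, PowerSeries.coeff_X_pow,
    eq_comm (a := k), Finset.sum_boole, Nat.card_eq_fintype_card, Fintype.card_subtype]

theorem constantCoeff_denominator :
    PowerSeries.constantCoeff ((1 - PowerSeries.X ^ 8) * (1 - PowerSeries.X ^ 12) : PowerSeries ℚ)
      ≠ 0 := by
  simp

theorem countingSeries_eq_rationalSeries {r : ℕ} (d : Fin r → ℕ) :
    countingSeries (fun p : (Fin r × ℕ) × ℕ => d p.1.1 + 8 * p.1.2 + 12 * p.2) =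
      rationalSeries d := by
  have h1 := countingSeries_prod (deg := d) (fun k => inferInstance) (n := 8) (by norm_num)
  have h2 := countingSeries_prod (deg := fun p : Fin r × ℕ => d p.1 + 8 * p.2)
    (finite_fiber_prod (fun k => inferInstance) (by norm_num)) (n := 12) (by norm_num)
  rw [rationalSeries, PowerSeries.eq_mul_inv_iff_mul_eq constantCoeff_denominator,
    ← countingSeries_fintype, ← h1, ← h2]
  ring

/-- The vector `P ↦ ∑ⱼ Pⱼ(θ, φ) Fⱼ`. -/
def combination {m r : ℕ} (F : Fin r → Fin m → MvPolynomial (Fin 2) ℂ) :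
    (Fin r → MvPolynomial (Fin 2) ℂ) →ₗ[ℂ] (Fin m → MvPolynomial (Fin 2) ℂ) where
  toFun P i := ∑ j, aeval ![θ, φ] (P j) * F j i
  map_add' P Q := by
    funext i
    simp [add_mul, Finset.sum_add_distrib]
  map_smul' c P := by
    funext i
    simp [Finset.smul_sum]

theorem mem_invariantRing_iff_exists_aeval {f : MvPolynomial (Fin 2) ℂ} :
    f ∈ invariantRing 𝒢 ↔ ∃ P : MvPolynomial (Fin 2) ℂ, aeval ![θ, φ] P = f := by
  rw [invariantRing_eq_adjoin, ← Matrix.range_cons_cons_empty θ φ ![],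
    Algebra.adjoin_range_eq_range_aeval, AlgHom.mem_range]

theorem aeval_mem_invariantRing (P : MvPolynomial (Fin 2) ℂ) :
    aeval ![θ, φ] P ∈ invariantRing 𝒢 :=
  mem_invariantRing_iff_exists_aeval.2 ⟨P, rfl⟩

theorem combination_eq_coe {m r : ℕ} {ρ : 𝒢 →* GL (Fin m) ℂ}
    {F : Fin r → Fin m → MvPolynomial (Fin 2) ℂ} (hF : ∀ j, F j ∈ vectorInvariants ρ)
    (P : Fin r → MvPolynomial (Fin 2) ℂ) :
    combination F P = ((∑ j, (⟨_, aeval_mem_invariantRing (P j)⟩ : invariantRing 𝒢) •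
      (⟨F j, hF j⟩ : vectorInvariants ρ) : vectorInvariants ρ) :
      Fin m → MvPolynomial (Fin 2) ℂ) := by
  rw [sum_smul_apply]
  funext i
  simp only [combination, LinearMap.coe_mk, AddHom.coe_mk, Matrix.mulVec, dotProduct]
  exact Finset.sum_congr rfl fun j _ => mul_comm _ _

theorem combination_injective {m r : ℕ} {ρ : 𝒢 →* GL (Fin m) ℂ}
    {F : Fin r → Fin m → MvPolynomial (Fin 2) ℂ} (hfree : IsFreeOn ρ F) :
    Function.Injective (combination F) := by
  obtain ⟨b, hb⟩ := hfree
  have hF : ∀ j, F j ∈ vectorInvariants ρ := fun j => hb j ▸ (b j).property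
  have hb' : (fun j => (⟨F j, hF j⟩ : vectorInvariants ρ)) = b :=
    funext fun j => Subtype.ext (hb j).symm
  intro P Q hPQ
  rw [combination_eq_coe hF, combination_eq_coe hF] at hPQ
  have hli := b.linearIndependent
  rw [← hb'] at hli
  have h := Fintype.linearIndependent_iffₛ.1 hli _ _ (Subtype.ext hPQ)
  funext j
  exact algebraicIndependent_θ_φ (congrArg Subtype.val (h j))

theorem range_combination {m r : ℕ} {ρ : 𝒢 →* GL (Fin m) ℂ}
    {F : Fin r → Fin m → MvPolynomial (Fin 2) ℂ} (hfree : IsFreeOn ρ F) :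
    LinearMap.range (combination F) = (vectorInvariants ρ).restrictScalars ℂ := by
  obtain ⟨b, hb⟩ := hfree
  have hF : ∀ j, F j ∈ vectorInvariants ρ := fun j => hb j ▸ (b j).property
  have hb' : (fun j => (⟨F j, hF j⟩ : vectorInvariants ρ)) = b :=
    funext fun j => Subtype.ext (hb j).symm
  refine le_antisymm ?_ fun V hV => ?_
  · rintro _ ⟨P, rfl⟩
    rw [combination_eq_coe hF]
    exact Subtype.property _
  · have hex := fun j => mem_invariantRing_iff_exists_aeval.1 (b.repr ⟨V, hV⟩ j).property
    choose P hP using hex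
    refine ⟨P, ?_⟩
    rw [combination_eq_coe hF]
    have h : ∀ j, (⟨_, aeval_mem_invariantRing (P j)⟩ : invariantRing 𝒢) = b.repr ⟨V, hV⟩ j :=
      fun j => Subtype.ext (hP j)
    simp only [h, fun j => congrFun hb' j]
    exact congrArg Subtype.val (b.sum_repr ⟨V, hV⟩)

theorem finrank_degreePart {m r : ℕ} {ρ : 𝒢 →* GL (Fin m) ℂ}
    {F : Fin r → Fin m → MvPolynomial (Fin 2) ℂ} {d : Fin r → ℕ} (hfree : IsFreeOn ρ F)
    (hd : HasDegrees F d) (k : ℕ) :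
    Module.finrank ℂ (degreePart ρ k) =
      Nat.card {p : (Fin r × ℕ) × ℕ // d p.1.1 + 8 * p.1.2 + 12 * p.2 = k} := by
  let ε : (Σ _ : Fin r, (Fin 2 →₀ ℕ)) ≃ (Fin r × ℕ) × ℕ :=
    ((Equiv.sigmaEquivProd _ _).trans
      ((Equiv.refl _).prodCongr (Finsupp.equivFunOnFinite.trans (finTwoArrowEquiv ℕ)))).trans
      (Equiv.prodAssoc _ _ _).symm
  let B := (Pi.basis fun _ : Fin r => basisMonomials (Fin 2) ℂ).reindex ε
  let v : (Fin r × ℕ) × ℕ → Fin m → MvPolynomial (Fin 2) ℂ := fun p i =>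
    θ ^ p.1.2 * φ ^ p.2 * F p.1.1 i
  have hv : combination F ∘ B = v := by
    funext p i
    obtain ⟨⟨j, s⟩, rfl⟩ := ε.surjective p
    have hB : B (ε ⟨j, s⟩) = Pi.single j (monomial s 1) := by
      simp [B]
    rw [Function.comp_apply, hB]
    simp only [combination, LinearMap.coe_mk, AddHom.coe_mk]
    rw [Finset.sum_eq_single j]
    · have hs : aeval ![θ, φ] (monomial s (1 : ℂ)) = θ ^ s 0 * φ ^ s 1 := by
        rw [aeval_monomial, Finsupp.prod_fintype _ _ (by simp), Fin.prod_univ_two, map_one, one_mul]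
        rfl
      rw [Pi.single_eq_same, hs]
      rfl
    · intro l _ hl
      simp [hl]
    · simp
  have hli : LinearIndependent ℂ v := by
    rw [← hv]
    exact B.linearIndependent.map' _ (LinearMap.ker_eq_bot.2 (combination_injective hfree))
  have hspan : Submodule.span ℂ (Set.range v) = (vectorInvariants ρ).restrictScalars ℂ := by
    rw [← hv, Set.range_comp, ← Submodule.map_span, B.span_eq, Submodule.map_top,
      range_combination hfree]
  have hhom : ∀ p i, (v p i).IsHomogeneous (d p.1.1 + 8 * p.1.2 + 12 * p.2) := by
    intro p i
    have h := ((isHomogeneous_θ.pow p.1.2).mul (isHomogeneous_φ.pow p.2)).mul (hd p.1.1 i)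
    rwa [show 8 * p.1.2 + 12 * p.2 + d p.1.1 = d p.1.1 + 8 * p.1.2 + 12 * p.2 by ring] at h
  let w : {p : (Fin r × ℕ) × ℕ // d p.1.1 + 8 * p.1.2 + 12 * p.2 = k} →
      Fin m → MvPolynomial (Fin 2) ℂ := fun p => v p.val
  have hdeg : degreePart ρ k = Submodule.span ℂ (Set.range w) := by
    refine le_antisymm ?_ ?_
    · rintro V ⟨hV, hVk⟩
      -- project onto the homogeneous components of degree `k`
      let π := (homogeneousComponent (σ := Fin 2) (R := ℂ) k).compLeft (Fin m)
      have hπV : π V = V := funext fun i =>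
        homogeneousComponent_eq_self (hVk i (Set.mem_univ i))
      have hV' : V ∈ Submodule.span ℂ (Set.range v) := hspan ▸ hV
      have hle : Submodule.span ℂ (Set.range v) ≤ (Submodule.span ℂ (Set.range w)).comap π := by
        rw [Submodule.span_le]
        rintro _ ⟨p, rfl⟩
        rw [SetLike.mem_coe, Submodule.mem_comap]
        by_cases hp : d p.1.1 + 8 * p.1.2 + 12 * p.2 = k
        · have : π (v p) = w ⟨p, hp⟩ := funext fun i =>
            homogeneousComponent_eq_self (hp ▸ hhom p i)
          rw [this]
          exact Submodule.subset_span ⟨_, rfl⟩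
        · have : π (v p) = 0 := funext fun i =>
            (homogeneousComponent_of_mem (hhom p i)).trans (if_neg fun h => hp h.symm)
          rw [this]
          exact zero_mem _
      have := hle hV'
      rwa [Submodule.mem_comap, hπV] at this
    · rw [Submodule.span_le]
      rintro _ ⟨p, rfl⟩
      refine ⟨hspan ▸ Submodule.subset_span ⟨p.val, rfl⟩, fun i _ => ?_⟩
      have := hhom p.val i
      rwa [p.property] at this
  have hfin : Finite {p : (Fin r × ℕ) × ℕ // d p.1.1 + 8 * p.1.2 + 12 * p.2 = k} :=
    finite_fiber_prod (finite_fiber_prod (fun k => inferInstance) (by norm_num)) (by norm_num) k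
  have := Fintype.ofFinite {p : (Fin r × ℕ) × ℕ // d p.1.1 + 8 * p.1.2 + 12 * p.2 = k}
  have hw : LinearIndependent ℂ w := hli.comp _ Subtype.val_injective
  rw [hdeg, finrank_span_eq_card hw, Nat.card_eq_fintype_card]

theorem hilbertSeries_eq_rationalSeries {m r : ℕ} {ρ : 𝒢 →* GL (Fin m) ℂ}
    {F : Fin r → Fin m → MvPolynomial (Fin 2) ℂ} {d : Fin r → ℕ} (hfree : IsFreeOn ρ F)
    (hd : HasDegrees F d) : hilbertSeries ρ = rationalSeries d := by
  rw [← countingSeries_eq_rationalSeries]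
  ext k
  simp only [hilbertSeries, countingSeries, PowerSeries.coeff_mk, finrank_degreePart hfree hd]

/-- The first coefficients of the rational function are found by division with remainder; `Q` is
the remainder divided by `tⁿ`. -/
theorem trunc_rationalSeries {r : ℕ} {d : Fin r → ℕ} {n : ℕ} {P : Polynomial ℚ}
    (hP : P.natDegree < n) (Q : Polynomial ℚ)
    (h : ∑ j, Polynomial.X ^ d j = P * ((1 - Polynomial.X ^ 8) * (1 - Polynomial.X ^ 12)) +
      Polynomial.X ^ n * Q) : (rationalSeries d).trunc n = P := by
  set K : PowerSeries ℚ := ((1 - PowerSeries.X ^ 8) * (1 - PowerSeries.X ^ 12))⁻¹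
  have hK : ((1 - PowerSeries.X ^ 8) * (1 - PowerSeries.X ^ 12)) * K = 1 :=
    PowerSeries.mul_inv_cancel _ constantCoeff_denominator
  have h1 := congrArg (fun p : Polynomial ℚ => (p : PowerSeries ℚ)) h
  simp only [Polynomial.coe_add, Polynomial.coe_mul, Polynomial.coe_sub, Polynomial.coe_pow,
    Polynomial.coe_X, Polynomial.coe_one] at h1
  have h2 : ((∑ j, Polynomial.X ^ d j : Polynomial ℚ) : PowerSeries ℚ) =
      ∑ j, PowerSeries.X ^ d j := by
    rw [← Polynomial.coeToPowerSeries.ringHom_apply, map_sum]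
    simp
  have h3 : rationalSeries d =
      (P : PowerSeries ℚ) + PowerSeries.X ^ n * ((Q : PowerSeries ℚ) * K) := by
    rw [rationalSeries, ← h2, h1]
    linear_combination (P : PowerSeries ℚ) * hK
  ext k
  rw [PowerSeries.coeff_trunc]
  split_ifs with hk
  · rw [h3, map_add, PowerSeries.coeff_X_pow_mul', if_neg (by omega), add_zero,
      Polynomial.coeff_coe]
  · rw [Polynomial.coeff_eq_zero_of_natDegree_lt (by omega)]

/-! ### The five representations -/

/-- The substitution `f(x, y) ↦ f(x + y, x - y)`, which is `T` without its scalar factor. -/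
def hadamard : MvPolynomial (Fin 2) ℂ →ₐ[ℂ] MvPolynomial (Fin 2) ℂ :=
  aeval ![x + y, x - y]

theorem subst_T_eq_hadamard {f : MvPolynomial (Fin 2) ℂ} {d : ℕ} (hf : f.IsHomogeneous d) :
    subst T f = C (((1 + Complex.I) / 2) ^ d) * hadamard f := by
  have h : subst T = hadamard.comp (scale ((1 + Complex.I) / 2) ((1 + Complex.I) / 2)) := by
    ext1 i
    fin_cases i
    · exact subst_T_x.trans (by simp [scale, hadamard, x, y])
    · exact subst_T_y.trans (by simp [scale, hadamard, x, y])
  rw [h, AlgHom.comp_apply, scale_of_isHomogeneous hf, map_mul, algHom_C, algebraMap_eq]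

theorem half_one_add_I_pow_four : ((1 + Complex.I) / 2) ^ 4 = -1 / 4 := by
  linear_combination (1 / 16 * Complex.I ^ 2 + 1 / 4 * Complex.I + 5 / 16) * Complex.I_sq

/-- The value of a representation on `T` is checked on forms after pulling out the scalar
`((1 + i)/2) ^ d`, so that only polynomials with integral coefficients remain. -/
theorem subst_T_eq_matMulVec {m : ℕ} {F : Fin m → MvPolynomial (Fin 2) ℂ} {d : ℕ}
    (hF : ∀ i, (F i).IsHomogeneous d) {M : Matrix (Fin m) (Fin m) ℂ} (s : ℂ)
    (hM : ∀ i, hadamard (F i) = C s * matMulVec M F i) {a : ℂ}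
    (ha : ((1 + Complex.I) / 2) ^ d * s = a) :
    (fun i => subst T (F i)) = matMulVec (a • M) F := by
  funext i
  rw [subst_T_eq_hadamard (hF i), hM, ← mul_assoc, ← map_mul, ha]
  simp only [matMulVec, Matrix.mulVec, dotProduct, Finset.mul_sum, Matrix.map_apply,
    Matrix.smul_apply, smul_eq_mul, map_mul, mul_assoc]

/-- The criteria for one representation together: the representation is the one spanned by the
entries of one of the vectors, and the vectors are a basis of its module of invariants. -/
theorem exists_representation_isFreeOn {m : ℕ} {F : Fin m → Fin m → MvPolynomial (Fin 2) ℂ}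
    {A : Matrix (Fin m) (Fin m) ℂ} {e d : Fin m → ℕ} (he : ∀ i, e i < 4)
    (heinj : Function.Injective e) (hd : HasDegrees F d)
    (hT : ∀ j, (fun i => subst T (F j i)) = matMulVec A (F j))
    (hD : ∀ j i, subst D (F j i) = C (Complex.I ^ e i) * F j i) (k : Fin m)
    (h0 : ∀ i, F k i ≠ 0) (hcol : ∀ i, A i k ≠ 0) (hrow : ∀ i, A k i ≠ 0)
    {c : ℂ} (hc : c ≠ 0) (hdet : (Matrix.of F).det = C c * mirrorProduct ^ (∑ i, e i)) :
    ∃ ρ : 𝒢 →* GL (Fin m) ℂ, HasValues ρ A (Matrix.diagonal fun i => Complex.I ^ e i) ∧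
      (linearRep ρ).IsIrreducible ∧ IsFreeOn ρ F ∧ HasDegrees F d ∧
      hilbertSeries ρ = rationalSeries d := by
  have hinj : Function.Injective fun i => Complex.I ^ e i := fun i j hij => heinj <| by
    have h := I_pow_eq_I_pow_iff.1 hij
    rwa [Nat.mod_eq_of_lt (he i), Nat.mod_eq_of_lt (he j)] at h
  have hD' : ∀ j, (fun i => subst D (F j i)) =
      matMulVec (Matrix.diagonal fun i => Complex.I ^ e i) (F j) := fun j => by
    funext i
    rw [matMulVec, Matrix.diagonal_map (map_zero C), Matrix.mulVec_diagonal, hD]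
  obtain ⟨ρ, hρ⟩ := exists_representation (linearIndependent_of_subst_D hinj h0 (hD k)) (hT k)
    (hD' k)
  have hfree : IsFreeOn ρ F := isFreeOn_of_det he hρ
    (fun j => (mem_vectorInvariants_iff ρ hρ).2 ⟨hT j, hD' j⟩) hc hdet
  exact ⟨ρ, hρ, isIrreducible_of_diagonal hρ hinj k hcol hrow, hfree, hd,
    hilbertSeries_eq_rationalSeries hfree hd⟩

theorem scale_x (a b : ℂ) : scale a b x = C a * x := by simp [scale, x]

theorem scale_y (a b : ℂ) : scale a b y = C b * y := by simp [scale, y]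

theorem hadamard_x : hadamard x = x + y := by simp [hadamard, x]

theorem hadamard_y : hadamard y = x - y := by simp [hadamard, y]

theorem C_I_pow_add_four (n : ℕ) :
    (C Complex.I : MvPolynomial (Fin 2) ℂ) ^ (n + 4) = C Complex.I ^ n := by
  rw [pow_add, C_I_pow_four, mul_one]

theorem C_I_pow_three : (C Complex.I : MvPolynomial (Fin 2) ℂ) ^ 3 = -C Complex.I := by
  rw [pow_succ, C_I_sq, neg_one_mul]

theorem hasDegrees_gen₃ : HasDegrees gen₃ ![6] := by
  intro j i
  refine isHomogeneous_of_scale ?_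
  fin_cases j
  fin_cases i
  simp [gen₃, scale_x, scale_y, map_ofNat]
  ring

theorem subst_D_gen₃ (j i : Fin 1) :
    subst D (gen₃ j i) = C (Complex.I ^ (![1] i : ℕ)) * gen₃ j i := by
  fin_cases j
  fin_cases i
  simp [gen₃, subst_D_x, subst_D_y, mul_pow, C_I_pow_add_four]
  ring

/-! The degree of the `j`-th generator increases by four with `j`, so that undoing the scalar
`((1 + i)/2) ^ d` in `hadamard` contributes the factor `(-4) ^ j`. -/

theorem hadamard_gen₃ (j i : Fin 1) :
    hadamard (gen₃ j i) = C (8 * (-4) ^ (j : ℕ)) * matMulVec !![1] (gen₃ j) i := by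
  fin_cases j
  fin_cases i
  simp [gen₃, hadamard_x, hadamard_y, map_ofNat, matMulVec, Matrix.mulVec, dotProduct]
  ring

theorem subst_T_gen₃ (j : Fin 1) :
    (fun i => subst T (gen₃ j i)) = matMulVec ((-Complex.I) • !![1]) (gen₃ j) := by
  refine subst_T_eq_matMulVec (hasDegrees_gen₃ j) _ (hadamard_gen₃ j) ?_
  have h2 : ((1 + Complex.I) / 2) ^ 2 = Complex.I / 2 := by
    rw [pow_two, half_one_add_I_sq]
  have h := half_one_add_I_pow_four
  fin_cases j
  generalize (1 + Complex.I) / 2 = w at *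
  simp
  linear_combination 8 * w ^ 2 * h - 2 * h2

theorem det_gen₃ : (Matrix.of gen₃).det = C 1 * mirrorProduct ^ 1 := by
  simp [gen₃, mirrorProduct]

theorem hasDegrees_gen₅ : HasDegrees gen₅ ![4, 8] := by
  intro j i
  refine isHomogeneous_of_scale ?_
  fin_cases j <;> fin_cases i <;>
    simp [gen₅, scale_x, scale_y, map_ofNat] <;> ring

theorem subst_D_gen₅ (j i : Fin 2) :
    subst D (gen₅ j i) = C (Complex.I ^ (![0, 2] i : ℕ)) * gen₅ j i := by
  fin_cases j <;> fin_cases i <;>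
    simp [gen₅, subst_D_x, subst_D_y, map_ofNat, mul_pow, C_I_pow_add_four, C_I_sq]
  ring

theorem hadamard_gen₅ (j i : Fin 2) :
    hadamard (gen₅ j i) = C (2 * (-4) ^ (j : ℕ)) * matMulVec !![1, 1; 3, -1] (gen₅ j) i := by
  fin_cases j <;> fin_cases i <;>
    simp [gen₅, hadamard_x, hadamard_y, map_ofNat, matMulVec, Matrix.mulVec, dotProduct,
      Fin.sum_univ_two] <;> ring

theorem subst_T_gen₅ (j : Fin 2) :
    (fun i => subst T (gen₅ j i)) = matMulVec ((-1 / 2 : ℂ) • !![1, 1; 3, -1]) (gen₅ j) := by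
  refine subst_T_eq_matMulVec (hasDegrees_gen₅ j) _ (hadamard_gen₅ j) ?_
  have h := half_one_add_I_pow_four
  fin_cases j <;> generalize (1 + Complex.I) / 2 = w at * <;> simp
  · linear_combination 2 * h
  · linear_combination (-8 * w ^ 4 + 2) * h

theorem det_gen₅ : (Matrix.of gen₅).det = C 18 * mirrorProduct ^ 2 := by
  simp [Matrix.det_fin_two, gen₅, mirrorProduct, map_ofNat]
  ring

theorem hasDegrees_gen₁₀ : HasDegrees gen₁₀ ![1, 5] := by
  intro j i
  refine isHomogeneous_of_scale ?_
  fin_cases j <;> fin_cases i <;>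
    simp [gen₁₀, scale_x, scale_y, map_ofNat] <;> ring

theorem subst_D_gen₁₀ (j i : Fin 2) :
    subst D (gen₁₀ j i) = C (Complex.I ^ (![0, 1] i : ℕ)) * gen₁₀ j i := by
  fin_cases j <;> fin_cases i <;>
    simp [gen₁₀, subst_D_x, subst_D_y, map_ofNat, mul_pow, C_I_pow_add_four]
  ring

theorem hadamard_gen₁₀ (j i : Fin 2) :
    hadamard (gen₁₀ j i) = C ((-4) ^ (j : ℕ)) * matMulVec !![1, 1; 1, -1] (gen₁₀ j) i := by
  fin_cases j <;> fin_cases i <;>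
    simp [gen₁₀, hadamard_x, hadamard_y, map_ofNat, matMulVec, Matrix.mulVec, dotProduct,
      Fin.sum_univ_two] <;> ring

theorem subst_T_gen₁₀ (j : Fin 2) :
    (fun i => subst T (gen₁₀ j i)) =
      matMulVec (((1 + Complex.I) / 2) • !![1, 1; 1, -1]) (gen₁₀ j) := by
  refine subst_T_eq_matMulVec (hasDegrees_gen₁₀ j) _ (hadamard_gen₁₀ j) ?_
  have h := half_one_add_I_pow_four
  fin_cases j <;> generalize (1 + Complex.I) / 2 = w at * <;> simp
  linear_combination -4 * w * h

theorem det_gen₁₀ : (Matrix.of gen₁₀).det = C (-6) * mirrorProduct ^ 1 := by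
  simp [Matrix.det_fin_two, gen₁₀, mirrorProduct, map_ofNat]
  ring

theorem hasDegrees_gen₁₃ : HasDegrees gen₁₃ ![2, 6, 10] := by
  intro j i
  refine isHomogeneous_of_scale ?_
  fin_cases j <;> fin_cases i <;>
    simp [gen₁₃, scale_x, scale_y, map_ofNat] <;> ring

theorem subst_D_gen₁₃ (j i : Fin 3) :
    subst D (gen₁₃ j i) = C (Complex.I ^ (![0, 1, 2] i : ℕ)) * gen₁₃ j i := by
  fin_cases j <;> fin_cases i <;>
    simp [gen₁₃, subst_D_x, subst_D_y, map_ofNat, mul_pow, C_I_pow_add_four, C_I_sq] <;> ring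

theorem hadamard_gen₁₃ (j i : Fin 3) :
    hadamard (gen₁₃ j i) = C ((-4) ^ (j : ℕ)) *
      matMulVec !![1, 2, 1; 1, 0, -1; 1, -2, 1] (gen₁₃ j) i := by
  fin_cases j <;> fin_cases i <;>
    simp [gen₁₃, hadamard_x, hadamard_y, map_ofNat, matMulVec, Matrix.mulVec, dotProduct,
      Fin.sum_univ_three] <;> ring

theorem subst_T_gen₁₃ (j : Fin 3) :
    (fun i => subst T (gen₁₃ j i)) =
      matMulVec ((Complex.I / 2) • !![1, 2, 1; 1, 0, -1; 1, -2, 1]) (gen₁₃ j) := by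
  refine subst_T_eq_matMulVec (hasDegrees_gen₁₃ j) _ (hadamard_gen₁₃ j) ?_
  have h := half_one_add_I_pow_four
  rw [← half_one_add_I_sq]
  fin_cases j <;> generalize (1 + Complex.I) / 2 = w at * <;> simp
  · ring
  · linear_combination -4 * w ^ 2 * h
  · linear_combination w ^ 2 * (16 * w ^ 4 - 4) * h

theorem det_gen₁₃ : (Matrix.of gen₁₃).det = C 108 * mirrorProduct ^ 3 := by
  simp [Matrix.det_fin_three, gen₁₃, mirrorProduct, map_ofNat]
  ring

theorem hasDegrees_gen₁₅ : HasDegrees gen₁₅ ![3, 7, 11, 15] := by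
  intro j i
  refine isHomogeneous_of_scale ?_
  fin_cases j <;> fin_cases i <;>
    simp [gen₁₅, scale_x, scale_y, map_ofNat] <;> ring

theorem subst_D_gen₁₅ (j i : Fin 4) :
    subst D (gen₁₅ j i) = C (Complex.I ^ (![0, 1, 2, 3] i : ℕ)) * gen₁₅ j i := by
  fin_cases j <;> fin_cases i <;>
    simp [gen₁₅, subst_D_x, subst_D_y, map_ofNat, mul_pow, C_I_pow_add_four, C_I_sq,
      C_I_pow_three] <;> ring

theorem hadamard_gen₁₅ (j i : Fin 4) : hadamard (gen₁₅ j i) = C ((-4) ^ (j : ℕ)) *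
    matMulVec !![1, 3, 3, 1; 1, 1, -1, -1; 1, -1, -1, 1; 1, -3, 3, -1] (gen₁₅ j) i := by
  fin_cases j <;> fin_cases i <;>
    simp [gen₁₅, hadamard_x, hadamard_y, map_ofNat, matMulVec, Matrix.mulVec, dotProduct,
      Fin.sum_univ_four] <;> ring

theorem subst_T_gen₁₅ (j : Fin 4) : (fun i => subst T (gen₁₅ j i)) =
    matMulVec (((-1 + Complex.I) / 4) •
      !![1, 3, 3, 1; 1, 1, -1, -1; 1, -1, -1, 1; 1, -3, 3, -1]) (gen₁₅ j) := by
  refine subst_T_eq_matMulVec (hasDegrees_gen₁₅ j) _ (hadamard_gen₁₅ j) ?_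
  have h := half_one_add_I_pow_four
  have h3 : ((1 + Complex.I) / 2) ^ 3 = (-1 + Complex.I) / 4 := by
    linear_combination (3 / 8 + 1 / 8 * Complex.I) * Complex.I_sq
  rw [← h3]
  fin_cases j <;> generalize (1 + Complex.I) / 2 = w at * <;> simp
  · linear_combination -4 * w ^ 3 * h
  · linear_combination w ^ 3 * (16 * w ^ 4 - 4) * h
  · linear_combination w ^ 3 * (-64 * w ^ 8 + 16 * w ^ 4 - 4) * h

theorem det_gen₁₅ : (Matrix.of gen₁₅).det = C (-36) * mirrorProduct ^ 6 := by
  simp [Matrix.det_succ_row_zero, Fin.sum_univ_succ, gen₁₅, mirrorProduct, Fin.succAbove, map_ofNat]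
  ring

theorem exists_representation_isFreeOn₃ : ∃ ρ : 𝒢 →* GL (Fin 1) ℂ,
    HasValues ρ !![-Complex.I] !![Complex.I] ∧
      (linearRep ρ).IsIrreducible ∧ IsFreeOn ρ gen₃ ∧ HasDegrees gen₃ ![6] ∧
      hilbertSeries ρ = rationalSeries ![6] := by
  have hB : (Matrix.diagonal fun i => Complex.I ^ (![1] i : ℕ)) = !![Complex.I] := by
    ext i j
    fin_cases i
    fin_cases j
    simp
  have hA : !![-Complex.I] = (-Complex.I) • !![1] := by simp
  rw [← hB, hA]
  refine exists_representation_isFreeOn (by decide) (by decide) hasDegrees_gen₃ subst_T_gen₃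
    subst_D_gen₃ 0 (fun i h => ?_) ?_ ?_ (c := 1) (by norm_num) det_gen₃
  · -- no entry vanishes at the point `(1, 2)`
    have := congrArg (eval ![1, 2]) h
    fin_cases i
    norm_num [gen₃, x, y] at this
  · intro i
    fin_cases i
    simp [Complex.ext_iff]
  · intro i
    fin_cases i
    simp [Complex.ext_iff]

theorem exists_representation_isFreeOn₅ : ∃ ρ : 𝒢 →* GL (Fin 2) ℂ,
    HasValues ρ ((-1 / 2 : ℂ) • !![1, 1; 3, -1]) (Matrix.diagonal ![1, -1]) ∧
      (linearRep ρ).IsIrreducible ∧ IsFreeOn ρ gen₅ ∧ HasDegrees gen₅ ![4, 8] ∧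
      hilbertSeries ρ = rationalSeries ![4, 8] := by
  have hB : (Matrix.diagonal fun i => Complex.I ^ (![0, 2] i : ℕ)) =
      Matrix.diagonal ![1, -1] := by
    ext i j
    fin_cases i <;> fin_cases j <;> simp
  rw [← hB]
  refine exists_representation_isFreeOn (by decide) (by decide) hasDegrees_gen₅ subst_T_gen₅
    subst_D_gen₅ 0 (fun i h => ?_) ?_ ?_ (c := 18) (by norm_num) det_gen₅
  · -- no entry vanishes at the point `(1, 2)`
    have := congrArg (eval ![1, 2]) h
    fin_cases i <;> norm_num [gen₅, x, y] at this
  · intro i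
    fin_cases i <;> simp
  · intro i
    fin_cases i <;> simp

theorem exists_representation_isFreeOn₁₀ : ∃ ρ : 𝒢 →* GL (Fin 2) ℂ,
    HasValues ρ T.val D.val ∧
      (linearRep ρ).IsIrreducible ∧ IsFreeOn ρ gen₁₀ ∧ HasDegrees gen₁₀ ![1, 5] ∧
      hilbertSeries ρ = rationalSeries ![1, 5] := by
  have hB : (Matrix.diagonal fun i => Complex.I ^ (![0, 1] i : ℕ)) = D.val := by
    ext i j
    fin_cases i <;> fin_cases j <;> simp [D_val]
  rw [← hB, T_val]
  refine exists_representation_isFreeOn (by decide) (by decide) hasDegrees_gen₁₀ subst_T_gen₁₀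
    subst_D_gen₁₀ 0 (fun i h => ?_) ?_ ?_ (c := -6) (by norm_num) det_gen₁₀
  · -- no entry vanishes at the point `(1, 2)`
    have := congrArg (eval ![1, 2]) h
    fin_cases i <;> norm_num [gen₁₀, x, y] at this
  · intro i
    fin_cases i <;> simp [Complex.ext_iff]
  · intro i
    fin_cases i <;> simp [Complex.ext_iff]

theorem exists_representation_isFreeOn₁₃ : ∃ ρ : 𝒢 →* GL (Fin 3) ℂ,
    HasValues ρ ((Complex.I / 2) • !![1, 2, 1; 1, 0, -1; 1, -2, 1])
        (Matrix.diagonal ![1, Complex.I, -1]) ∧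
      (linearRep ρ).IsIrreducible ∧ IsFreeOn ρ gen₁₃ ∧ HasDegrees gen₁₃ ![2, 6, 10] ∧
      hilbertSeries ρ = rationalSeries ![2, 6, 10] := by
  have hB : (Matrix.diagonal fun i => Complex.I ^ (![0, 1, 2] i : ℕ)) =
      Matrix.diagonal ![1, Complex.I, -1] := by
    ext i j
    fin_cases i <;> fin_cases j <;> simp
  rw [← hB]
  refine exists_representation_isFreeOn (by decide) (by decide) hasDegrees_gen₁₃ subst_T_gen₁₃
    subst_D_gen₁₃ 0 (fun i h => ?_) ?_ ?_ (c := 108) (by norm_num) det_gen₁₃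
  · -- no entry vanishes at the point `(1, 2)`
    have := congrArg (eval ![1, 2]) h
    fin_cases i <;> norm_num [gen₁₃, x, y] at this
  · intro i
    fin_cases i <;> simp [Complex.ext_iff]
  · intro i
    fin_cases i <;> simp [Complex.ext_iff]

theorem exists_representation_isFreeOn₁₅ : ∃ ρ : 𝒢 →* GL (Fin 4) ℂ,
    HasValues ρ (((-1 + Complex.I) / 4) •
          !![1, 3, 3, 1; 1, 1, -1, -1; 1, -1, -1, 1; 1, -3, 3, -1])
        (Matrix.diagonal ![1, Complex.I, -1, -Complex.I]) ∧
      (linearRep ρ).IsIrreducible ∧ IsFreeOn ρ gen₁₅ ∧ HasDegrees gen₁₅ ![3, 7, 11, 15] ∧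
      hilbertSeries ρ = rationalSeries ![3, 7, 11, 15] := by
  have hB : (Matrix.diagonal fun i => Complex.I ^ (![0, 1, 2, 3] i : ℕ)) =
      Matrix.diagonal ![1, Complex.I, -1, -Complex.I] := by
    ext i j
    fin_cases i <;> fin_cases j <;> simp
  rw [← hB]
  refine exists_representation_isFreeOn (by decide) (by decide) hasDegrees_gen₁₅ subst_T_gen₁₅
    subst_D_gen₁₅ 0 (fun i h => ?_) ?_ ?_ (c := -36) (by norm_num) det_gen₁₅
  · -- no entry vanishes at the point `(1, 2)`
    have := congrArg (eval ![1, 2]) h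
    fin_cases i <;> norm_num [gen₁₅, x, y] at this
  · intro i
    fin_cases i <;> simp [Complex.ext_iff]
  · intro i
    fin_cases i <;> simp [Complex.ext_iff]

end VectorInvariants

end

open VectorInvariants Polynomial in
theorem mainTheorem1 :
    -- the group and its invariant ring
    (Nat.card 𝒢 = 96 ∧ θ.IsHomogeneous 8 ∧ φ.IsHomogeneous 12 ∧
      AlgebraicIndependent ℂ ![θ, φ] ∧ invariantRing 𝒢 = Algebra.adjoin ℂ {θ, φ}) ∧
    -- part 1
    (∃ ρ₃ : 𝒢 →* GL (Fin 1) ℂ,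
      HasValues ρ₃ !![-Complex.I] !![Complex.I] ∧
      (linearRep ρ₃).IsIrreducible ∧
      IsFreeOn ρ₃ gen₃ ∧ HasDegrees gen₃ ![6] ∧
      hilbertSeries ρ₃ = rationalSeries ![6] ∧
      (hilbertSeries ρ₃).trunc 27 = (X ^ 6 + X ^ 14 + X ^ 18 + X ^ 22 + X ^ 26 : ℚ[X])) ∧
    -- part 2
    (∃ ρ₅ : 𝒢 →* GL (Fin 2) ℂ,
      HasValues ρ₅ ((-1 / 2 : ℂ) • !![1, 1; 3, -1]) (Matrix.diagonal ![1, -1]) ∧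
      (linearRep ρ₅).IsIrreducible ∧
      IsFreeOn ρ₅ gen₅ ∧ HasDegrees gen₅ ![4, 8] ∧
      hilbertSeries ρ₅ = rationalSeries ![4, 8] ∧
      (hilbertSeries ρ₅).trunc 21 =
        (X ^ 4 + X ^ 8 + X ^ 12 + 2 * X ^ 16 + 2 * X ^ 20 : ℚ[X])) ∧
    -- part 3
    (∃ ρ₁₀ : 𝒢 →* GL (Fin 2) ℂ,
      HasValues ρ₁₀ T.val D.val ∧
      (linearRep ρ₁₀).IsIrreducible ∧
      IsFreeOn ρ₁₀ gen₁₀ ∧ HasDegrees gen₁₀ ![1, 5] ∧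
      hilbertSeries ρ₁₀ = rationalSeries ![1, 5] ∧
      (hilbertSeries ρ₁₀).trunc 22 =
        (X + X ^ 5 + X ^ 9 + 2 * X ^ 13 + 2 * X ^ 17 + 2 * X ^ 21 : ℚ[X])) ∧
    -- part 4
    (∃ ρ₁₃ : 𝒢 →* GL (Fin 3) ℂ,
      HasValues ρ₁₃ ((Complex.I / 2) • !![1, 2, 1; 1, 0, -1; 1, -2, 1])
          (Matrix.diagonal ![1, Complex.I, -1]) ∧
      (linearRep ρ₁₃).IsIrreducible ∧
      IsFreeOn ρ₁₃ gen₁₃ ∧ HasDegrees gen₁₃ ![2, 6, 10] ∧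
      hilbertSeries ρ₁₃ = rationalSeries ![2, 6, 10] ∧
      (hilbertSeries ρ₁₃).trunc 23 =
        (X ^ 2 + X ^ 6 + 2 * X ^ 10 + 2 * X ^ 14 + 3 * X ^ 18 + 3 * X ^ 22 : ℚ[X])) ∧
    -- part 5
    (∃ ρ₁₅ : 𝒢 →* GL (Fin 4) ℂ,
      HasValues ρ₁₅
          (((-1 + Complex.I) / 4) •
            !![1, 3, 3, 1; 1, 1, -1, -1; 1, -1, -1, 1; 1, -3, 3, -1])
          (Matrix.diagonal ![1, Complex.I, -1, -Complex.I]) ∧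
      (linearRep ρ₁₅).IsIrreducible ∧
      IsFreeOn ρ₁₅ gen₁₅ ∧ HasDegrees gen₁₅ ![3, 7, 11, 15] ∧
      hilbertSeries ρ₁₅ = rationalSeries ![3, 7, 11, 15] ∧
      (hilbertSeries ρ₁₅).trunc 24 =
        (X ^ 3 + X ^ 7 + 2 * X ^ 11 + 3 * X ^ 15 + 3 * X ^ 19 + 4 * X ^ 23 : ℚ[X])) := by
  refine ⟨⟨card_𝒢, isHomogeneous_θ, isHomogeneous_φ, algebraicIndependent_θ_φ,
    invariantRing_eq_adjoin⟩, ?_, ?_, ?_, ?_, ?_⟩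
  · obtain ⟨ρ, hρ, hirr, hfree, hdeg, hhilb⟩ := exists_representation_isFreeOn₃
    refine ⟨ρ, hρ, hirr, hfree, hdeg, hhilb, hhilb ▸ trunc_rationalSeries (by compute_degree!)
      (2 * X ^ 3 + X ^ 7 - X ^ 15 - X ^ 19) ?_⟩
    simp
    ring
  · obtain ⟨ρ, hρ, hirr, hfree, hdeg, hhilb⟩ := exists_representation_isFreeOn₅
    refine ⟨ρ, hρ, hirr, hfree, hdeg, hhilb, hhilb ▸ trunc_rationalSeries (by compute_degree!)
      (2 * X ^ 3 + 3 * X ^ 7 + X ^ 11 - 2 * X ^ 15 - 2 * X ^ 19) ?_⟩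
    simp [Fin.sum_univ_succ]
    ring
  · obtain ⟨ρ, hρ, hirr, hfree, hdeg, hhilb⟩ := exists_representation_isFreeOn₁₀
    refine ⟨ρ, hρ, hirr, hfree, hdeg, hhilb, hhilb ▸ trunc_rationalSeries (by compute_degree!)
      (3 * X ^ 3 + 3 * X ^ 7 - 2 * X ^ 15 - 2 * X ^ 19) ?_⟩
    simp [Fin.sum_univ_succ]
    ring
  · obtain ⟨ρ, hρ, hirr, hfree, hdeg, hhilb⟩ := exists_representation_isFreeOn₁₃
    refine ⟨ρ, hρ, hirr, hfree, hdeg, hhilb, hhilb ▸ trunc_rationalSeries (by compute_degree!)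
      (4 * X ^ 3 + 4 * X ^ 7 + X ^ 11 - 3 * X ^ 15 - 3 * X ^ 19) ?_⟩
    simp [Fin.sum_univ_succ]
    ring
  · obtain ⟨ρ, hρ, hirr, hfree, hdeg, hhilb⟩ := exists_representation_isFreeOn₁₅
    refine ⟨ρ, hρ, hirr, hfree, hdeg, hhilb, hhilb ▸ trunc_rationalSeries (by compute_degree!)
      (5 * X ^ 3 + 5 * X ^ 7 + X ^ 11 - 3 * X ^ 15 - 4 * X ^ 19) ?_⟩
    simp [Fin.sum_univ_succ]
    ring
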